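/- Let $\mathcal M$ be the space of locally finite complex-valued measures on $\mathbb R^d$ (complex-valued set functions $\varphi$ on the bounded Borel sets that are countably additive on disjoint unions that are bounded), with the $\sigma$-algebra generated by the evaluations $\varphi\mapsto\varphi(A)$, $A$ bounded Borel. For $\varphi\in\mathcal M$ let $|\varphi|$ be its total variation measure (the smallest non-negative measure with $|\varphi(A)|\le|\varphi|(A)$ for all bounded Borel $A$), and let $(T_x\varphi)(A)=\varphi(A-x)$. Let $\varPhi$ be a random element of $\mathcal M$, defined on some probability space, that is stationary (its law is invariant under all $T_x$) and locally square integrable, i.e. $\mathbb E\big[(|\mathrm{Re}\,\varPhi|(A))^2+(|\mathrm{Im}\,\varPhi|(A))^2\big]<\infty$ for all bounded Borel sets $A$. Let $\lambda$ be Lebesgue measure and $\rho=\mathbb E\big[|\varPhi|([0,1)^d)\big]$. Then the following hold. 1. (Polar decomposition) For every realisation there is a measurable phase function $\varPhi_{\rm ph}:\mathbb R^d\to[0,2\pi)$ with $\varPhi(A)=\int_A \mathrm e^{\mathrm i\varPhi_{\rm ph}}\,\mathrm d|\varPhi|$ for all bounded Borel $A$; fix one for each realisation. 2. (Intensity) $\rho<\infty$,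 and $\mathbb E[|\varPhi|(A)]=\rho\,\lambda(A)$ for every Borel set $A$. 3. (Campbell measure) There is a $\sigma$-finite measure $\mathcal C$ on $\mathbb R^d\times\mathcal M$, namely the average over the underlying probability space of the image of $|\varPhi|$ under $x\mapsto(x,\mathrm e^{-\mathrm i\varPhi_{\rm ph}(x)}\varPhi)$, such that for all measurable $g\ge 0$ the inner integral below is a random variable and $$\int g\,\mathrm d\mathcal C=\mathbb E\Big[\int_{\mathbb R^d} g\big(x,\mathrm e^{-\mathrm i\varPhi_{\rm ph}(x)}\varPhi\big)\,\mathrm d|\varPhi|(x)\Big].$$ Its projection to $\mathbb R^d$ is $\rho\lambda$. 4. (Palm distributions) There is a measurable family $(P_x)_{x\in\mathbb R^d}$ of probability measures on $\mathcal M$ with $$\int g\,\mathrm d\mathcal C=\int_{\mathbb R^d}\int_{\mathcal M} g(x,\varphi)\,\mathrm dP_x(\varphi)\,\rho\,\mathrm d\lambda(x)\qquad\text{for all measurable } g\ge 0,$$ and $P_x=T_xP_0$ for all $x$. If $\rho>0$, then every measurable family $(P'_x)$ of probability measures with this disintegration property satisfies $P'_x=T_xP_0$ for $\lambda$-almost every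 $x$. 5. (Second moments) There is a unique locally finite complex-valued measure $\mu^{(2)}$ on $\mathbb R^d\times\mathbb R^d$ with $\mu^{(2)}(A\times A')=\mathbb E\big[\varPhi(A)\overline{\varPhi(A')}\big]$ for all bounded Borel $A,A'$ (the random variable $\varPhi(A)\overline{\varPhi(A')}$ being integrable), and a unique $\mu^{(2)}_{\rm red}\in\mathcal M$ with $$\int f\,\mathrm d\mu^{(2)}=\int_{\mathbb R^d}\int_{\mathbb R^d}f(u+v,u)\,\mathrm d\mu^{(2)}_{\rm red}(v)\,\mathrm d\lambda(u)$$ for all continuous compactly supported $f:\mathbb R^d\times\mathbb R^d\to\mathbb C$. 6. For every measurable family $(P_x)$ of probability measures that disintegrates $\mathcal C$ as in 4 and satisfies $P_x=T_xP_0$ for all $x$, and every bounded Borel set $A$, $$\mu^{(2)}_{\rm red}(A)=\rho\int_{\mathcal M}\varphi(A)\,\mathrm dP_0(\varphi),$$ where for $\rho>0$ the function $\varphi\mapsto\varphi(A)$ is $P_0$-integrable (for $\rho=0$ the right-hand side is $0$). That is, $\mu^{(2)}_{\rm red}=\rho\,I_{P_0}$ with $I_{P_0}$ the first moment measure of $P_0$.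 -/

import Mathlib

open MeasureTheory ProbabilityTheory Set Bornology
open scoped ENNReal

noncomputable section

/-- A locally finite complex-valued measure on `X`: a complex-valued function on the bounded
measurable sets that is countably additive whenever the (disjoint) union is bounded.  The value on
every other set is `0` by convention, so that two such measures are equal as soon as they agree
on bounded measurable sets. -/
structure LFComplexMeasure (X : Type*) [MeasurableSpace X] [Bornology X] where
  toFun : Set X → ℂ
  eq_zero' : ∀ A : Set X, ¬ (MeasurableSet A ∧ IsBounded A) → toFun A = 0
  hasSum' : ∀ f : ℕ → Set X, (∀ i, MeasurableSet (f i)) → IsBounded (⋃ i, f i) →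
    Pairwise (Function.onFun Disjoint f) → HasSum (fun i => toFun (f i)) (toFun (⋃ i, f i))

namespace LFComplexMeasure

section General

variable {X : Type*} [MeasurableSpace X] [Bornology X]

instance instCoeFun : CoeFun (LFComplexMeasure X) (fun _ => Set X → ℂ) := ⟨toFun⟩

theorem ext_bounded {φ ψ : LFComplexMeasure X}
    (h : ∀ A : Set X, MeasurableSet A → IsBounded A → φ A = ψ A) : φ = ψ := by
  have : φ.toFun = ψ.toFun := by
    funext A
    by_cases hA : MeasurableSet A ∧ IsBounded A
    · exact h A hA.1 hA.2
    · rw [φ.eq_zero' A hA, ψ.eq_zero' A hA]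
  cases φ
  cases ψ
  simpa using this

/-- The σ-algebra on the space of locally finite complex-valued measures generated by the
evaluations `φ ↦ φ A` at bounded measurable sets `A`. -/
instance instMeasurableSpace : MeasurableSpace (LFComplexMeasure X) :=
  ⨆ A : {A : Set X // MeasurableSet A ∧ IsBounded A},
    MeasurableSpace.comap (fun φ : LFComplexMeasure X => φ A.1) inferInstance

theorem measurable_eval (A : Set X) : Measurable (fun φ : LFComplexMeasure X => φ A) := by
  by_cases hA : MeasurableSet A ∧ IsBounded A
  · exact (comap_measurable (fun φ : LFComplexMeasure X => φ A)).mono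
      (le_iSup (fun A : {A : Set X // MeasurableSet A ∧ IsBounded A} =>
        MeasurableSpace.comap (fun φ : LFComplexMeasure X => φ A.1) inferInstance) ⟨A, hA⟩) le_rfl
  · have : (fun φ : LFComplexMeasure X => φ A) = fun _ => 0 := by
      funext φ
      exact φ.eq_zero' A hA
    rw [this]
    exact measurable_const

theorem measurable_of_eval {Ω : Type*} [MeasurableSpace Ω] {F : Ω → LFComplexMeasure X}
    (h : ∀ A : Set X, MeasurableSet A → IsBounded A → Measurable (fun ω => F ω A)) :
    Measurable F := by
  refine Measurable.of_comap_le ?_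
  rw [instMeasurableSpace, MeasurableSpace.comap_iSup]
  refine iSup_le fun A => ?_
  rw [MeasurableSpace.comap_comp]
  exact (h A.1 A.2.1 A.2.2).comap_le

/-- The measure `c φ` for a complex number `c`. -/
instance instSMul : SMul ℂ (LFComplexMeasure X) where
  smul c φ :=
    { toFun := fun A => c * φ A
      eq_zero' := fun A hA => by simp [φ.eq_zero' A hA]
      hasSum' := fun f hf hb hd => (φ.hasSum' f hf hb hd).mul_left c }

@[simp] theorem smul_apply (c : ℂ) (φ : LFComplexMeasure X) (A : Set X) :
    (c • φ) A = c * φ A := rfl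

/-- The real part of a locally finite complex-valued measure. -/
def rePart (φ : LFComplexMeasure X) : LFComplexMeasure X where
  toFun A := ((φ A).re : ℂ)
  eq_zero' A hA := by simp [φ.eq_zero' A hA]
  hasSum' f hf hb hd := by
    simpa using (φ.hasSum' f hf hb hd).mapL (Complex.ofRealCLM.comp Complex.reCLM)

/-- The imaginary part (a real-valued measure) of a locally finite complex-valued measure. -/
def imPart (φ : LFComplexMeasure X) : LFComplexMeasure X where
  toFun A := ((φ A).im : ℂ)
  eq_zero' A hA := by simp [φ.eq_zero' A hA]
  hasSum' f hf hb hd := by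
    simpa using (φ.hasSum' f hf hb hd).mapL (Complex.ofRealCLM.comp Complex.imCLM)

/-- The total variation measure `|φ|`: the smallest non-negative measure `ν` such that
`|φ(A)| ≤ ν(A)` for all bounded measurable `A`. -/
def totalVariation (φ : LFComplexMeasure X) : Measure X :=
  sInf {ν : Measure X | ∀ A : Set X, MeasurableSet A → IsBounded A → ‖φ A‖ₑ ≤ ν A}

/-- `α` is a phase function of `φ`: it is measurable with values in `[0, 2π)`, and `φ` has
the density `exp (i α)` with respect to `|φ|`. -/
def IsPhase (φ : LFComplexMeasure X) (α : X → ℝ) : Prop :=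
  Measurable α ∧ (∀ x, α x ∈ Set.Ico 0 (2 * Real.pi)) ∧
    ∀ A : Set X, MeasurableSet A → IsBounded A →
      φ A = ∫ x in A, Complex.exp (Complex.I * α x) ∂φ.totalVariation

open Classical in
/-- A phase function of `φ` (unique up to `|φ|`-null sets). -/
def phase (φ : LFComplexMeasure X) : X → ℝ :=
  if h : ∃ α : X → ℝ, φ.IsPhase α then h.choose else fun _ => 0

/-- The integral of `f` with respect to `φ`, through the polar decomposition of `φ`. -/
def integral (φ : LFComplexMeasure X) (f : X → ℂ) : ℂ :=
  ∫ x, f x * Complex.exp (Complex.I * φ.phase x) ∂φ.totalVariation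

end General

section Translation

variable {d : ℕ}

/-- The translate `T_x φ`, given by `(T_x φ)(A) = φ(A - x)`. -/
def translate (x : EuclideanSpace ℝ (Fin d)) (φ : LFComplexMeasure (EuclideanSpace ℝ (Fin d))) :
    LFComplexMeasure (EuclideanSpace ℝ (Fin d)) where
  toFun A := φ ((fun y => y + x) ⁻¹' A)
  eq_zero' A hA := by
    refine φ.eq_zero' _ fun h => hA ⟨?_, ?_⟩
    · exact (MeasurableEquiv.addRight x).measurableSet_preimage.1 h.1
    · have h2 : A ⊆ (fun y => y + x) '' ((fun y => y + x) ⁻¹' A) := by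
        intro a ha
        exact ⟨a - x, by simpa using ha, by simp⟩
      exact ((LipschitzWith.id.add (LipschitzWith.const x)).isBounded_image h.2).subset h2
  hasSum' f hf hb hd := by
    rw [Set.preimage_iUnion]
    refine φ.hasSum' (fun i => (fun y => y + x) ⁻¹' f i)
      (fun i => measurable_add_const x (hf i)) ?_ (fun i j hij => (hd hij).preimage _)
    rw [← Set.preimage_iUnion]
    have h2 : (fun y => y + x) ⁻¹' (⋃ i, f i) ⊆ (fun y => y - x) '' (⋃ i, f i) := by
      intro a ha
      exact ⟨a + x, ha, by simp⟩
    exact ((LipschitzWith.id.sub (LipschitzWith.const x)).isBounded_image hb).subset h2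

theorem measurable_translate (x : EuclideanSpace ℝ (Fin d)) :
    Measurable (translate x) :=
  measurable_of_eval fun A _ _ => measurable_eval ((fun y => y + x) ⁻¹' A)

end Translation

end LFComplexMeasure

section RandomMeasure

variable {d : ℕ} {Θ : Type*} [MeasurableSpace Θ]

/-- The law of the random measure `Φ` is invariant under all translations. -/
def IsStationaryRM (π : Measure Θ) (Φ : Θ → LFComplexMeasure (EuclideanSpace ℝ (Fin d))) : Prop :=
  ∀ x : EuclideanSpace ℝ (Fin d),
    (π.map Φ).map (LFComplexMeasure.translate x) = π.map Φ

/-- `E[|Re Φ|(A)² + |Im Φ|(A)²] < ∞` for all bounded Borel sets `A`. -/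
def IsLocallySquareIntegrableRM (π : Measure Θ)
    (Φ : Θ → LFComplexMeasure (EuclideanSpace ℝ (Fin d))) : Prop :=
  ∀ A : Set (EuclideanSpace ℝ (Fin d)), MeasurableSet A → IsBounded A →
    ∫⁻ θ, ((Φ θ).rePart.totalVariation A ^ 2 + (Φ θ).imPart.totalVariation A ^ 2) ∂π < ∞

/-- The intensity `ρ` of `|Φ|`: the mean mass that `|Φ|` gives to the unit cube. -/
def intensityRM (π : Measure Θ) (Φ : Θ → LFComplexMeasure (EuclideanSpace ℝ (Fin d))) : ℝ≥0∞ :=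
  ∫⁻ θ, (Φ θ).totalVariation {x | ∀ i, x i ∈ Set.Ico (0 : ℝ) 1} ∂π

/-- The map `x ↦ (x, exp(-i α(x)) φ)`, where `α` is the phase function of `φ`. -/
def rotatedPair (φ : LFComplexMeasure (EuclideanSpace ℝ (Fin d)))
    (x : EuclideanSpace ℝ (Fin d)) :
    EuclideanSpace ℝ (Fin d) × LFComplexMeasure (EuclideanSpace ℝ (Fin d)) :=
  (x, Complex.exp (-Complex.I * φ.phase x) • φ)

/-- The Campbell measure of the complex-valued random measure `Φ`: the mixture over `π` of the
images of `|Φ|` under `x ↦ (x, exp(-i α(x)) Φ)`, where `α` is the phase function of `Φ`. -/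
def campbellRM (π : Measure Θ) (Φ : Θ → LFComplexMeasure (EuclideanSpace ℝ (Fin d))) :
    Measure (EuclideanSpace ℝ (Fin d) × LFComplexMeasure (EuclideanSpace ℝ (Fin d))) :=
  π.bind fun θ => (Φ θ).totalVariation.map (rotatedPair (Φ θ))

/-- The probability measures `P x` disintegrate the Campbell measure with respect to
`ρ` times Lebesgue measure. -/
def IsPalmFamily (π : Measure Θ) (Φ : Θ → LFComplexMeasure (EuclideanSpace ℝ (Fin d)))
    (P : Kernel (EuclideanSpace ℝ (Fin d)) (LFComplexMeasure (EuclideanSpace ℝ (Fin d)))) : Prop :=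
  IsMarkovKernel P ∧
    ∀ g : EuclideanSpace ℝ (Fin d) × LFComplexMeasure (EuclideanSpace ℝ (Fin d)) → ℝ≥0∞,
      Measurable g →
        ∫⁻ z, g z ∂(campbellRM π Φ) =
          ∫⁻ x, ∫⁻ φ, g (x, φ) ∂(P x) ∂(intensityRM π Φ • volume)

/-- `μ₂` is the second moment measure: `μ₂(A × A') = E[Φ(A) conj(Φ(A'))]`. -/
def IsSecondMomentMeasure (π : Measure Θ) (Φ : Θ → LFComplexMeasure (EuclideanSpace ℝ (Fin d)))
    (μ₂ : LFComplexMeasure (EuclideanSpace ℝ (Fin d) × EuclideanSpace ℝ (Fin d))) : Prop :=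
  ∀ A A' : Set (EuclideanSpace ℝ (Fin d)), MeasurableSet A → IsBounded A →
    MeasurableSet A' → IsBounded A' →
      Integrable (fun θ => Φ θ A * starRingEnd ℂ (Φ θ A')) π ∧
        μ₂ (A ×ˢ A') = ∫ θ, Φ θ A * starRingEnd ℂ (Φ θ A') ∂π

/-- `ν` is the measure obtained from `μ₂` by factoring out the diagonal translations:
`∫ f dμ₂ = ∫ ∫ f(u + v, u) dν(v) du` for all continuous `f` with compact support. -/
def IsReducedMeasure
    (μ₂ : LFComplexMeasure (EuclideanSpace ℝ (Fin d) × EuclideanSpace ℝ (Fin d)))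
    (ν : LFComplexMeasure (EuclideanSpace ℝ (Fin d))) : Prop :=
  ∀ f : EuclideanSpace ℝ (Fin d) × EuclideanSpace ℝ (Fin d) → ℂ,
    Continuous f → HasCompactSupport f →
      μ₂.integral f = ∫ u, ν.integral (fun v => f (u + v, u)) ∂volume

end RandomMeasure

end

section

open Filter Topology
open scoped symmDiff

/-! Write λ for Lebesgue measure, L for the law of Φ and C for its Campbell measure.

Everything rests on a polar decomposition φ = h(φ,·)|φ| with |h| = 1 and h measurable in φ and x
jointly (`exists_measurable_polar`). The phase is chosen for each φ separately and carries no
measurability in φ; since exp(i·phase) agrees with h(φ,·) up to |φ|-null sets, h replaces it in all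
integrals. Joint measurability comes from two facts: the positive part of a signed measure is a
supremum over a countable algebra, and one kernel dominated by another has a jointly measurable
density (`exists_measurable_kernel_density`).

Palm distributions. Translating φ by y moves the pair (x, conj h(φ,x) φ) to (x + y, T_y of the
second entry). By stationarity C is invariant under (x,φ) ↦ (x + y, T_y φ), so its image under (x,φ)
↦ (x, T_{-x}φ) is invariant under shifts of x alone. For each measurable G the x-marginal of the
part over G is then translation invariant and locally finite, hence a multiple of λ, and the image
is a product λ ⊗ Q (`centredCampbell_eq_prod`). The mass of Q is ρ, and normalising Q gives P₀; the
disintegration and the covariance P_x = T_x P₀ are read off the product. Almost sure uniqueness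
holds because the σ-algebra on the space of complex measures is countably generated.

Second moments. The measure μ₂ is the mean of φ ⊗ conj φ. By Fubini, ∫ f d(φ ⊗ conj φ) = ∫ conj
h(φ,y) (∫ f(x,y) dφ(x)) d|φ|(y). The factor conj h(φ,y) is the rotation built into the Campbell
measure, so averaging gives ∫ (∫ f(x,y) dψ(x)) dC(y,ψ). Inserting λ ⊗ Q yields ∫∫ f(u + v, u)
dI_Q(v) du, where I_Q is the first moment measure of Q = ρP₀ (`integral_mixture_prodConj`). Local
square integrability provides the domination. Rectangles determine μ₂, and test functions g(x -
y)k(y) with ∫ k = 1 determine the reduced measure. -/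

/-- The positive part of A is s(A ∩ P) for a Hahn set P, and P can be approximated in total
variation by sets of a generating algebra. For a countable algebra this exhibits the positive part
as a countable supremum of evaluations, hence measurable in s. -/
theorem MeasureTheory.SignedMeasure.toJordanDecomposition_posPart_apply_eq_iSup {X : Type*}
    [mX : MeasurableSpace X] (s : SignedMeasure X) {𝒜 : Set (Set X)} (h𝒜 : IsSetAlgebra 𝒜)
    (hgen : mX = MeasurableSpace.generateFrom 𝒜) {A : Set X} (hA : MeasurableSet A) :
    s.toJordanDecomposition.posPart A = ⨆ B ∈ 𝒜, ENNReal.ofReal (s (A ∩ B)) := by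
  have hmeas : ∀ B ∈ 𝒜, MeasurableSet B := fun B hB =>
    hgen ▸ MeasurableSpace.measurableSet_generateFrom hB
  apply le_antisymm
  · obtain ⟨P, hP, hP0, -, hpos, -⟩ := s.toJordanDecomposition_spec
    have hAP : s.toJordanDecomposition.posPart A = ENNReal.ofReal (s (A ∩ P)) := by
      rw [hpos, SignedMeasure.toMeasureOfZeroLE_apply s hP0 hP hA, inter_comm A P,
        ENNReal.ofReal, Real.toNNReal_of_nonneg]
    rw [hAP]
    refine ENNReal.le_of_forall_pos_le_add fun ε hε _ => ?_
    obtain ⟨B, hB, hBε⟩ := (Measure.MeasureDense.of_generateFrom_isSetAlgebra_finite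
      s.totalVariation h𝒜 hgen).approx P hP (measure_ne_top _ _) ε hε
    have hBm := hmeas B hB
    -- The two values differ by contributions of (A ∩ P) \ B and (A ∩ B) \ P, which are disjoint
    -- parts of P ∆ B and so have total variation at most ε together.
    have key : s (A ∩ P) ≤ s (A ∩ B) + ε := by
      have e1 : s (A ∩ P) = s (A ∩ P ∩ B) + s ((A ∩ P) \ B) :=
        by rw [← inter_union_sdiff (A ∩ P) B, VectorMeasure.of_union _
            ((hA.inter hP).inter hBm) ((hA.inter hP).diff hBm)]
           · simp
           · exact disjoint_sdiff_inter.symm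
      have e2 : s (A ∩ B) = s (A ∩ P ∩ B) + s ((A ∩ B) \ P) := by
        have h3 : A ∩ P ∩ B = A ∩ B ∩ P := by ext; simp; tauto
        rw [h3, ← VectorMeasure.of_union _ ((hA.inter hBm).inter hP) ((hA.inter hBm).diff hP),
          inter_union_sdiff]
        exact disjoint_sdiff_inter.symm
      have hu : (A ∩ P) \ B ∪ (A ∩ B) \ P ⊆ P ∆ B := by
        intro x; simp only [mem_union, Set.mem_sdiff, mem_inter_iff, mem_symmDiff]; tauto
      have hd : Disjoint ((A ∩ P) \ B) ((A ∩ B) \ P) := by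
        rw [Set.disjoint_left]; intro x; simp; tauto
      have m1 : MeasurableSet ((A ∩ P) \ B) := (hA.inter hP).diff hBm
      have m2 : MeasurableSet ((A ∩ B) \ P) := (hA.inter hBm).diff hP
      have htv : s.totalVariation.real ((A ∩ P) \ B) + s.totalVariation.real ((A ∩ B) \ P)
          ≤ ε := by
        rw [← measureReal_union hd m2]
        refine (measureReal_mono hu).trans ?_
        exact (ENNReal.toReal_mono ENNReal.ofReal_ne_top hBε.le).trans (by
          rw [ENNReal.toReal_ofReal ε.coe_nonneg])
      rw [e1, e2, s.apply_eq_posPart_real_sub_negPart_real m1,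
        s.apply_eq_posPart_real_sub_negPart_real m2]
      have t : ∀ C, s.totalVariation.real C = s.toJordanDecomposition.posPart.real C +
          s.toJordanDecomposition.negPart.real C := fun C => by
        rw [SignedMeasure.totalVariation, measureReal_add_apply]
      have p1 : 0 ≤ s.toJordanDecomposition.negPart.real ((A ∩ P) \ B) := measureReal_nonneg
      have p2 : 0 ≤ s.toJordanDecomposition.posPart.real ((A ∩ B) \ P) := measureReal_nonneg
      rw [t, t] at htv
      linarith
    calc ENNReal.ofReal (s (A ∩ P)) ≤ ENNReal.ofReal (s (A ∩ B) + ε) := ENNReal.ofReal_le_ofReal key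
      _ ≤ ENNReal.ofReal (s (A ∩ B)) + ENNReal.ofReal ε := ENNReal.ofReal_add_le
      _ ≤ _ := by
        gcongr
        · exact le_iSup₂ (f := fun B _ => ENNReal.ofReal (s (A ∩ B))) B hB
        · simp
  · refine iSup₂_le fun B hB => ?_
    rw [s.apply_eq_posPart_real_sub_negPart_real (hA.inter (hmeas B hB))]
    refine (ENNReal.ofReal_le_ofReal (sub_le_self _ measureReal_nonneg)).trans ?_
    rw [ofReal_measureReal]
    exact measure_mono inter_subset_left

namespace LFComplexMeasure

/-! ### A countable partition into bounded sets -/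

section Annulus

variable {X : Type*} [NormedAddCommGroup X]

/-- The points `x` with `n ≤ ‖x‖ < n + 1`. -/
def annulus (X : Type*) [NormedAddCommGroup X] (n : ℕ) : Set X := {x | ⌊‖x‖⌋₊ = n}

theorem measurableSet_annulus [MeasurableSpace X] [BorelSpace X] (n : ℕ) :
    MeasurableSet (annulus X n) :=
  (Nat.measurable_floor.comp measurable_norm) (measurableSet_singleton n)

theorem isBounded_annulus (n : ℕ) : IsBounded (annulus X n) := by
  refine isBounded_iff_forall_norm_le.2 ⟨n + 1, fun x hx => ?_⟩
  have : (⌊‖x‖⌋₊ : ℝ) = n := by exact_mod_cast hx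
  have h := Nat.lt_floor_add_one ‖x‖
  linarith

theorem pairwise_disjoint_annulus : Pairwise (Function.onFun Disjoint (annulus X)) := by
  intro i j hij
  refine Set.disjoint_left.2 fun x hi hj => hij ?_
  exact (show ⌊‖x‖⌋₊ = i from hi).symm.trans hj

theorem iUnion_annulus : ⋃ n, annulus X n = univ :=
  eq_univ_of_forall fun x => mem_iUnion.2 ⟨⌊‖x‖⌋₊, rfl⟩

theorem exists_inter_annulus_eq_empty {A : Set X} (hA : IsBounded A) :
    ∃ N, ∀ n, N ≤ n → A ∩ annulus X n = ∅ := by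
  obtain ⟨C, hC⟩ := isBounded_iff_forall_norm_le.1 hA
  refine ⟨⌊C⌋₊ + 1, fun n hn => ?_⟩
  by_contra h
  obtain ⟨x, hx, hxn⟩ := nonempty_iff_ne_empty.2 h
  have h1 : ⌊‖x‖⌋₊ = n := hxn
  have := Nat.floor_le_floor (hC x hx)
  omega

end Annulus

section Basic

variable {X : Type*} [MeasurableSpace X] [Bornology X]

/-- Additivity on a constant sequence of empty sets makes a constant series converge, so its terms
tend to zero. -/
theorem apply_empty (φ : LFComplexMeasure X) : φ ∅ = 0 := by
  have h := φ.hasSum' (fun _ => ∅) (fun _ => MeasurableSet.empty) (by simp)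
    (fun i j _ => disjoint_bot_left)
  simp only [iUnion_empty] at h
  exact tendsto_nhds_unique (tendsto_const_nhds) h.summable.tendsto_atTop_zero

theorem apply_union (φ : LFComplexMeasure X) {A B : Set X} (hA : MeasurableSet A)
    (hB : MeasurableSet B) (bA : IsBounded A) (bB : IsBounded B) (h : Disjoint A B) :
    φ (A ∪ B) = φ A + φ B := by
  have hU : (⋃ i, (fun n : ℕ => if n = 0 then A else if n = 1 then B else ∅) i) = A ∪ B := by
    ext x
    simp only [mem_iUnion, mem_union]
    constructor
    · rintro ⟨i, hi⟩
      split_ifs at hi <;> simp_all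
    · rintro (hx | hx)
      · exact ⟨0, by simpa⟩
      · exact ⟨1, by simpa⟩
  have h1 := φ.hasSum' (fun n => if n = 0 then A else if n = 1 then B else ∅)
    (fun n => by split_ifs <;> simp [hA, hB]) (by rw [hU]; exact bA.union bB) (by
      intro i j hij
      simp only [Function.onFun]
      split_ifs <;> simp_all [h.symm])
  rw [hU] at h1
  refine h1.unique ?_
  have h2 : HasSum (fun n : ℕ => φ (if n = 0 then A else if n = 1 then B else ∅))
      (∑ n ∈ {0, 1}, φ (if n = 0 then A else if n = 1 then B else ∅)) :=
    hasSum_sum_of_ne_finset_zero fun n hn => by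
      simp only [Finset.mem_insert, Finset.mem_singleton, not_or] at hn
      simp [hn.1, hn.2, apply_empty]
  convert h2 using 1
  simp

end Basic

/-! ### Jordan decomposition of the real part, measurably in φ -/

section Jordan

variable {X : Type*} [NormedAddCommGroup X] [MeasurableSpace X] [BorelSpace X]

open Classical in
/-- The real part of `φ`, restricted to an annulus, as a signed measure. -/
noncomputable def reAnnulus (φ : LFComplexMeasure X) (n : ℕ) : SignedMeasure X where
  measureOf' A := if MeasurableSet A then (φ (A ∩ annulus X n)).re else 0
  empty' := by simp [apply_empty]
  not_measurable' A hA := by simp [hA]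
  m_iUnion' f hf hd := by
    simp only [hf, MeasurableSet.iUnion hf, if_true]
    rw [iUnion_inter]
    exact (φ.hasSum' (fun i => f i ∩ annulus X n) (fun i => (hf i).inter (measurableSet_annulus n))
      ((isBounded_annulus (X := X) n).subset (iUnion_subset fun i => inter_subset_right))
      (fun i j hij => (hd hij).mono inter_subset_left inter_subset_left)).mapL Complex.reCLM

theorem reAnnulus_apply (φ : LFComplexMeasure X) (n : ℕ) {A : Set X} (hA : MeasurableSet A) :
    φ.reAnnulus n A = (φ (A ∩ annulus X n)).re := by
  classical
  exact if_pos hA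

theorem reAnnulus_neg (φ : LFComplexMeasure X) (n : ℕ) :
    ((-1 : ℂ) • φ).reAnnulus n = -φ.reAnnulus n := by
  ext A hA
  rw [neg_apply, reAnnulus_apply _ _ hA, reAnnulus_apply _ _ hA]
  simp

/-- The positive part of the real part of `φ`. -/
noncomputable def rePos (φ : LFComplexMeasure X) : Measure X :=
  Measure.sum fun n => (φ.reAnnulus n).toJordanDecomposition.posPart

theorem posPart_reAnnulus_eq_zero (φ : LFComplexMeasure X) (n : ℕ) {A : Set X}
    (hA : MeasurableSet A) (h : A ∩ annulus X n = ∅) :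
    (φ.reAnnulus n).toJordanDecomposition.posPart A = 0 := by
  obtain ⟨P, hP, hP0, -, hpos, -⟩ := (φ.reAnnulus n).toJordanDecomposition_spec
  have : φ.reAnnulus n (P ∩ A) = 0 := by
    rw [reAnnulus_apply _ _ (hP.inter hA), inter_assoc, h, inter_empty, apply_empty]
    simp
  rw [hpos, SignedMeasure.toMeasureOfZeroLE_apply _ hP0 hP hA]
  simp [this]

theorem rePos_apply_eq_sum (φ : LFComplexMeasure X) {A : Set X} (hA : MeasurableSet A) {N : ℕ}
    (hN : ∀ n, N ≤ n → A ∩ annulus X n = ∅) :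
    φ.rePos A = ∑ n ∈ Finset.range N, (φ.reAnnulus n).toJordanDecomposition.posPart A := by
  rw [rePos, Measure.sum_apply _ hA]
  refine tsum_eq_sum fun n hn => posPart_reAnnulus_eq_zero _ _ hA (hN n ?_)
  simpa using hn

theorem rePos_lt_top (φ : LFComplexMeasure X) {A : Set X} (hA : MeasurableSet A)
    (bA : IsBounded A) : φ.rePos A < ∞ := by
  obtain ⟨N, hN⟩ := exists_inter_annulus_eq_empty bA
  rw [rePos_apply_eq_sum φ hA hN]
  exact ENNReal.sum_lt_top.2 fun n _ => measure_lt_top _ _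

theorem apply_eq_sum_annulus (φ : LFComplexMeasure X) {A : Set X} (hA : MeasurableSet A)
    (bA : IsBounded A) {N : ℕ} (hN : ∀ n, N ≤ n → A ∩ annulus X n = ∅) :
    φ A = ∑ n ∈ Finset.range N, φ (A ∩ annulus X n) := by
  have h := φ.hasSum' (fun n => A ∩ annulus X n) (fun n => hA.inter (measurableSet_annulus n))
    (bA.subset (iUnion_subset fun i => inter_subset_left))
    (fun i j hij => (pairwise_disjoint_annulus hij).mono inter_subset_right inter_subset_right)
  rw [← inter_iUnion, iUnion_annulus, inter_univ] at h
  refine h.unique (hasSum_sum_of_ne_finset_zero fun n hn => ?_)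
  rw [hN n (by simpa using hn), apply_empty]

/-- Only finitely many annuli meet A, and on each this is the Jordan decomposition; the sign change
φ ↦ -φ exchanges positive and negative parts, so no separate negative part is needed. -/
theorem re_apply_eq (φ : LFComplexMeasure X) {A : Set X} (hA : MeasurableSet A)
    (bA : IsBounded A) :
    (φ A).re = φ.rePos.real A - ((-1 : ℂ) • φ).rePos.real A := by
  obtain ⟨N, hN⟩ := exists_inter_annulus_eq_empty bA
  rw [apply_eq_sum_annulus φ hA bA hN, measureReal_def, measureReal_def,
    rePos_apply_eq_sum _ hA hN, rePos_apply_eq_sum _ hA hN,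
    ENNReal.toReal_sum fun n _ => measure_ne_top _ _,
    ENNReal.toReal_sum fun n _ => measure_ne_top _ _, ← Finset.sum_sub_distrib, Complex.re_sum]
  refine Finset.sum_congr rfl fun n _ => ?_
  rw [← reAnnulus_apply φ n hA, SignedMeasure.apply_eq_posPart_real_sub_negPart_real _ hA,
    reAnnulus_neg, SignedMeasure.toJordanDecomposition_neg]
  rfl

variable [SecondCountableTopology X]

theorem exists_countable_setAlgebra (X : Type*) [mX : MeasurableSpace X]
    [MeasurableSpace.CountablyGenerated X] :
    ∃ 𝒜 : Set (Set X), 𝒜.Countable ∧ IsSetAlgebra 𝒜 ∧ mX = MeasurableSpace.generateFrom 𝒜 :=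
  ⟨generateSetAlgebra (MeasurableSpace.countableGeneratingSet X),
    countable_generateSetAlgebra MeasurableSpace.countable_countableGeneratingSet,
    isSetAlgebra_generateSetAlgebra, by
      rw [generateFrom_generateSetAlgebra_eq, MeasurableSpace.generateFrom_countableGeneratingSet]⟩

theorem measurable_rePos : Measurable (rePos : LFComplexMeasure X → Measure X) := by
  refine Measure.measurable_of_measurable_coe _ fun A hA => ?_
  simp only [rePos, Measure.sum_apply _ hA]
  refine Measurable.tsum fun n => ?_
  obtain ⟨𝒜, hc, h𝒜, hgen⟩ := exists_countable_setAlgebra X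
  have hmeas : ∀ B ∈ 𝒜, MeasurableSet B := fun B hB =>
    hgen ▸ MeasurableSpace.measurableSet_generateFrom hB
  simp only [SignedMeasure.toJordanDecomposition_posPart_apply_eq_iSup _ h𝒜 hgen hA]
  refine Measurable.biSup _ hc fun B hB => ?_
  simp only [reAnnulus_apply _ n (hA.inter (hmeas B hB))]
  exact ENNReal.measurable_ofReal.comp (Complex.measurable_re.comp (measurable_eval _))

end Jordan

/-! ### Densities of locally finite kernels -/

section KernelDensity

variable {X : Type*} [NormedAddCommGroup X] [MeasurableSpace X] [BorelSpace X]
  {Ω : Type*} [MeasurableSpace Ω]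

theorem sum_restrict_annulus (μ : Measure X) :
    Measure.sum (fun n => μ.restrict (annulus X n)) = μ := by
  rw [← Measure.restrict_iUnion pairwise_disjoint_annulus measurableSet_annulus, iUnion_annulus,
    Measure.restrict_univ]

theorem lintegral_eq_tsum_annulus (μ : Measure X) (f : X → ℝ≥0∞) :
    ∫⁻ x, f x ∂μ = ∑' n, ∫⁻ x in annulus X n, f x ∂μ := by
  conv_lhs => rw [← sum_restrict_annulus μ]
  rw [lintegral_sum_measure]

/-- A finite kernel needs a bound uniform in ω, which finiteness on each annulus does not give.
Dividing the restriction to an annulus by 1 plus its mass makes it uniformly bounded, and the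
divisor is restored as a finite density. -/
theorem isSFiniteKernel_of_annulus (κ : Kernel Ω X) (h : ∀ ω n, κ ω (annulus X n) < ∞) :
    IsSFiniteKernel κ := by
  have hm : ∀ n, Measurable fun ω => 1 + κ ω (annulus X n) := fun n =>
    measurable_const.add (κ.measurable_coe (measurableSet_annulus n))
  have hmeas : ∀ n, Measurable fun ω =>
      (1 + κ ω (annulus X n))⁻¹ • (κ ω).restrict (annulus X n) := fun n => by
    refine Measure.measurable_of_measurable_coe _ fun A hA => ?_
    simp only [Measure.smul_apply, Measure.restrict_apply hA, smul_eq_mul]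
    exact (hm n).inv.mul (κ.measurable_coe (hA.inter (measurableSet_annulus n)))
  let κ' : ℕ → Kernel Ω X := fun n => ⟨_, hmeas n⟩
  have hfin : ∀ n, IsFiniteKernel (κ' n) := fun n => ⟨1, ENNReal.one_lt_top, fun ω => by
    change ((1 + κ ω (annulus X n))⁻¹ • (κ ω).restrict (annulus X n)) univ ≤ 1
    rw [Measure.smul_apply, Measure.restrict_apply_univ, smul_eq_mul, mul_comm, ← div_eq_mul_inv]
    exact ENNReal.div_le_of_le_mul (by simp)⟩
  have hne : ∀ n ω, 1 + κ ω (annulus X n) ≠ ∞ := fun n ω =>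
    ENNReal.add_ne_top.2 ⟨ENNReal.one_ne_top, (h ω n).ne⟩
  have hκ : κ = Kernel.sum fun n => (κ' n).withDensity fun ω _ => 1 + κ ω (annulus X n) := by
    ext ω : 1
    rw [Kernel.sum_apply]
    conv_lhs => rw [← sum_restrict_annulus (κ ω)]
    congr 1 with n : 1
    rw [Kernel.withDensity_apply _ (by exact (hm n).comp measurable_fst), withDensity_const]
    change _ = _ • ((1 + κ ω (annulus X n))⁻¹ • (κ ω).restrict (annulus X n))
    rw [smul_smul, ENNReal.mul_inv_cancel (by simp) (hne n ω), one_smul]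
  rw [hκ]
  have := fun n => Kernel.IsSFiniteKernel.withDensity (κ' n)
    (f := fun ω _ => 1 + κ ω (annulus X n)) (fun ω _ => hne n ω)
  infer_instance

/-- The kernel Radon–Nikodym derivative is available for finite kernels. A common weight that is
strictly positive and finite makes both kernels finite and does not change the density of one with
respect to the other. -/
theorem exists_measurable_kernel_density [SecondCountableTopology X] (κ η : Kernel Ω X)
    (hκη : ∀ ω, κ ω ≤ η ω) (hη : ∀ ω n, η ω (annulus X n) < ∞) :
    ∃ r : Ω → X → ℝ≥0∞, Measurable (Function.uncurry r) ∧
      ∀ ω, κ ω = (η ω).withDensity (r ω) := by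
  have := isSFiniteKernel_of_annulus η hη
  have := isSFiniteKernel_of_annulus κ fun ω n => (hκη ω _).trans_lt (hη ω n)
  -- On the n-th annulus the weight gives η at most mass 2^{-(n+1)}, so the total is at most 1. It
  -- depends on x only through ⌊‖x‖⌋, which reduces joint measurability to a countable parameter.
  let g : Ω → X → ℝ≥0∞ := fun ω x =>
    (2⁻¹ : ℝ≥0∞) ^ (⌊‖x‖⌋₊ + 1) * (1 + η ω (annulus X ⌊‖x‖⌋₊))⁻¹
  have hg : Measurable (Function.uncurry g) := by
    have h1 : Measurable fun p : Ω × ℕ =>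
        (2⁻¹ : ℝ≥0∞) ^ (p.2 + 1) * (1 + η p.1 (annulus X p.2))⁻¹ :=
      measurable_from_prod_countable_left fun n => by
        have := η.measurable_coe (measurableSet_annulus (X := X) n)
        exact (this.const_add 1).inv.const_mul ((2⁻¹ : ℝ≥0∞) ^ (n + 1))
    exact h1.comp (measurable_fst.prodMk (Nat.measurable_floor.comp
      (measurable_norm.comp measurable_snd)))
  have hgω : ∀ ω, Measurable (g ω) := fun ω => hg.comp measurable_prodMk_left
  have hg0 : ∀ ω x, g ω x ≠ 0 := fun ω x => by
    refine mul_ne_zero (pow_ne_zero _ (by simp)) ?_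
    exact ENNReal.inv_ne_zero.2 (ENNReal.add_ne_top.2 ⟨ENNReal.one_ne_top, (hη ω _).ne⟩)
  have hgt : ∀ ω x, g ω x ≠ ∞ := fun ω x => by
    refine ENNReal.mul_ne_top (by simp) ?_
    simp
  have hfin : IsFiniteKernel (η.withDensity g) := ⟨1, ENNReal.one_lt_top, fun ω => by
    rw [Kernel.withDensity_apply _ hg, withDensity_apply _ MeasurableSet.univ,
      Measure.restrict_univ, lintegral_eq_tsum_annulus]
    have h2 : ∑' n : ℕ, (2⁻¹ : ℝ≥0∞) ^ (n + 1) = 1 := by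
      rw [ENNReal.tsum_geometric_add_one, ENNReal.one_sub_inv_two, inv_inv,
        ENNReal.inv_mul_cancel (by simp) (by simp)]
    rw [← h2]
    refine ENNReal.tsum_le_tsum fun n => ?_
    have h1 : ∫⁻ x in annulus X n, g ω x ∂(η ω) = ∫⁻ x in annulus X n,
        (2⁻¹ : ℝ≥0∞) ^ (n + 1) * (1 + η ω (annulus X n))⁻¹ ∂(η ω) := by
      refine setLIntegral_congr_fun (measurableSet_annulus n) fun x hx => ?_
      simp only [g, show ⌊‖x‖⌋₊ = n from hx]
    rw [h1, setLIntegral_const, mul_assoc]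
    refine mul_le_of_le_one_right zero_le ?_
    rw [mul_comm, ← div_eq_mul_inv]
    exact ENNReal.div_le_of_le_mul (by simp)⟩
  have hle : ∀ ω, (κ ω).withDensity (g ω) ≤ (η ω).withDensity (g ω) := fun ω =>
    Measure.le_iff.2 fun A hA => by
      rw [withDensity_apply _ hA, withDensity_apply _ hA]
      exact lintegral_mono' (Measure.restrict_mono subset_rfl (hκη ω)) le_rfl
  have hfin' : IsFiniteKernel (κ.withDensity g) := ⟨(η.withDensity g).bound,
      Kernel.bound_lt_top _, fun ω => by
    refine le_trans ?_ (Kernel.measure_le_bound (η.withDensity g) ω univ)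
    rw [Kernel.withDensity_apply _ hg, Kernel.withDensity_apply _ hg]
    exact hle ω univ⟩
  refine ⟨Kernel.rnDeriv (κ.withDensity g) (η.withDensity g), Kernel.measurable_rnDeriv _ _,
    fun ω => ?_⟩
  have hac : κ.withDensity g ω ≪ η.withDensity g ω := by
    rw [Kernel.withDensity_apply _ hg, Kernel.withDensity_apply _ hg]
    exact Measure.absolutelyContinuous_of_le (hle ω)
  have h := Kernel.withDensity_rnDeriv_eq hac
  set r := Kernel.rnDeriv (κ.withDensity g) (η.withDensity g) with hr
  have hrm : Measurable (Function.uncurry r) := Kernel.measurable_rnDeriv _ _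
  have hrω : Measurable (r ω) := hrm.comp measurable_prodMk_left
  rw [Kernel.withDensity_apply _ hrm, Kernel.withDensity_apply _ hg,
    Kernel.withDensity_apply _ hg, ← withDensity_mul _ (hgω ω) hrω, mul_comm,
    withDensity_mul _ hrω (hgω ω)] at h
  rw [← withDensity_inv_same (μ := κ ω) (hgω ω) (ae_of_all _ (hg0 ω)) (ae_of_all _ (hgt ω)), ← h,
    withDensity_inv_same (hgω ω) (ae_of_all _ (hg0 ω)) (ae_of_all _ (hgt ω))]

end KernelDensity

/-! ### Complex measures given by a density and a map -/

section Represents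

variable {X : Type*} [MeasurableSpace X] [Bornology X] {Z : Type*} [MeasurableSpace Z]

theorem measurable_smul :
    Measurable fun p : ℂ × LFComplexMeasure X => p.1 • p.2 :=
  measurable_of_eval fun A _ _ => measurable_fst.mul ((measurable_eval A).comp measurable_snd)

theorem measurable_const_smul (c : ℂ) :
    Measurable fun φ : LFComplexMeasure X => c • φ :=
  measurable_smul.comp measurable_prodMk_left

/-- `φ` is the image under `T` of the complex measure with density `H` with respect to `N`. -/
structure Represents (φ : LFComplexMeasure X) (N : Measure Z) (T : Z → X) (H : Z → ℂ) : Prop where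
  measurable_map : Measurable T
  measurable_density : Measurable H
  integrableOn : ∀ A, MeasurableSet A → IsBounded A → IntegrableOn H (T ⁻¹' A) N
  apply_eq : ∀ A, MeasurableSet A → IsBounded A → φ A = ∫ z in T ⁻¹' A, H z ∂N

variable {φ : LFComplexMeasure X} {N : Measure Z} {T : Z → X} {H : Z → ℂ}

theorem Represents.enorm_apply_le (h : φ.Represents N T H) {A : Set X} (hA : MeasurableSet A)
    (bA : IsBounded A) : ‖φ A‖ₑ ≤ ∫⁻ z in T ⁻¹' A, ‖H z‖ₑ ∂N := by
  rw [h.apply_eq A hA bA]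
  exact enorm_integral_le_lintegral_enorm _

theorem Represents.setIntegral_simpleFunc_mul {N : Measure X} {H : X → ℂ}
    (h : φ.Represents N id H) {A : Set X} (hA : MeasurableSet A) (bA : IsBounded A)
    (s : SimpleFunc X ℂ) :
    ∫ x in A, s x * H x ∂N = ∑ c ∈ s.range, c * φ (A ∩ s ⁻¹' {c}) := by
  have hU : A = ⋃ c ∈ s.range, A ∩ s ⁻¹' {c} := by
    ext x; simp
  have hm : ∀ c, MeasurableSet (A ∩ s ⁻¹' {c}) := fun c => hA.inter (s.measurableSet_fiber c)
  have heq : ∀ c, EqOn (fun x => s x * H x) (fun x => c * H x) (A ∩ s ⁻¹' {c}) := fun c x hx => by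
    have : s x = c := hx.2
    simp [this]
  conv_lhs => rw [hU]
  rw [integral_biUnion_finset _ fun c _ => hm c]
  · refine Finset.sum_congr rfl fun c _ => ?_
    rw [setIntegral_congr_fun (hm c) (heq c), integral_const_mul,
      h.apply_eq _ (hm c) (bA.subset inter_subset_left)]
    rfl
  · intro c _ c' _ hcc
    refine Set.disjoint_left.2 fun x hx hx' => hcc ?_
    exact (show s x = c from hx.2).symm.trans hx'.2
  · intro c _
    refine IntegrableOn.congr_fun ?_ (heq c).symm (hm c)
    exact (h.integrableOn _ (hm c) (bA.subset inter_subset_left)).const_mul c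

/-- This is the minimality half of |φ| = |H| N. For simple s with |s| ≤ 1 the integral of sH over A
is a finite sum of c φ(A ∩ {s = c}), hence bounded by ν(A); letting s approach conj(H)/|H| turns it
into the integral of |H|. -/
theorem Represents.setLIntegral_enorm_le {N : Measure X} {H : X → ℂ}
    (h : φ.Represents N id H) {ν : Measure X}
    (hν : ∀ A : Set X, MeasurableSet A → IsBounded A → ‖φ A‖ₑ ≤ ν A)
    {A : Set X} (hA : MeasurableSet A) (bA : IsBounded A) :
    ∫⁻ x in A, ‖H x‖ₑ ∂N ≤ ν A := by
  have hsimple : ∀ s : SimpleFunc X ℂ, (∀ x, ‖s x‖ ≤ 1) → ‖∫ x in A, s x * H x ∂N‖ₑ ≤ ν A := by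
    intro s hs
    have hm : ∀ c, MeasurableSet (A ∩ s ⁻¹' {c}) := fun c => hA.inter (s.measurableSet_fiber c)
    rw [h.setIntegral_simpleFunc_mul hA bA]
    calc ‖∑ c ∈ s.range, c * φ (A ∩ s ⁻¹' {c})‖ₑ
        ≤ ∑ c ∈ s.range, ‖c * φ (A ∩ s ⁻¹' {c})‖ₑ := enorm_sum_le _ _
      _ ≤ ∑ c ∈ s.range, ν (A ∩ s ⁻¹' {c}) := by
        refine Finset.sum_le_sum fun c hc => ?_
        obtain ⟨x, rfl⟩ := SimpleFunc.mem_range.1 hc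
        rw [enorm_mul]
        refine (mul_le_of_le_one_left zero_le ?_).trans
          (hν _ (hm _) (bA.subset inter_subset_left))
        rw [← ofReal_norm]
        exact ENNReal.ofReal_le_one.2 (hs x)
      _ = ν (⋃ c ∈ s.range, A ∩ s ⁻¹' {c}) := by
        rw [measure_biUnion_finset _ fun c _ => hm c]
        intro c _ c' _ hcc
        refine Set.disjoint_left.2 fun x hx hx' => hcc ?_
        exact (show s x = c from hx.2).symm.trans hx'.2
      _ ≤ ν A := measure_mono (iUnion₂_subset fun c _ => inter_subset_left)
  have hint : IntegrableOn H A N := h.integrableOn A hA bA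
  let u : X → ℂ := fun x => starRingEnd ℂ (H x) / ‖H x‖
  have hum : StronglyMeasurable u := by
    have := h.measurable_density
    exact ((Complex.continuous_conj.measurable.comp this).div
      (Complex.measurable_ofReal.comp this.norm)).stronglyMeasurable
  have hu1 : ∀ x, ‖u x‖ ≤ 1 := fun x => by
    simp only [u, norm_div, RCLike.norm_conj, Complex.norm_real, norm_norm]
    exact div_self_le_one _
  have huH : ∀ x, u x * H x = ‖H x‖ := fun x => by
    by_cases hx : H x = 0
    · simp [u, hx]
    · have : (‖H x‖ : ℂ) ≠ 0 := by simpa using hx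
      simp only [u]
      rw [div_mul_eq_mul_div, mul_comm, Complex.mul_conj, Complex.normSq_eq_norm_sq]
      field_simp
      push_cast
      ring
  have hlim : Tendsto (fun n => ∫ x in A, hum.approxBounded 1 n x * H x ∂N) atTop
      (𝓝 (∫ x in A, u x * H x ∂N)) := by
    refine tendsto_integral_of_dominated_convergence (fun x => ‖H x‖) (fun n => ?_) hint.norm
      (fun n => ae_of_all _ fun x => ?_) (ae_of_all _ fun x => ?_)
    · exact ((hum.approxBounded 1 n).stronglyMeasurable.mul
        h.measurable_density.stronglyMeasurable).aestronglyMeasurable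
    · rw [norm_mul]
      exact mul_le_of_le_one_left (norm_nonneg _) (hum.norm_approxBounded_le zero_le_one n x)
    · exact (hum.tendsto_approxBounded_of_norm_le (hu1 x)).mul_const _
  have h2 : ‖∫ x in A, u x * H x ∂N‖ₑ ≤ ν A :=
    le_of_tendsto hlim.enorm (Eventually.of_forall fun n =>
      hsimple _ fun x => hum.norm_approxBounded_le zero_le_one n x)
  refine le_trans (le_of_eq ?_) h2
  simp only [huH]
  rw [integral_complex_ofReal, ← ofReal_norm, Complex.norm_real, Real.norm_of_nonneg
    (integral_nonneg fun x => norm_nonneg _), ofReal_integral_norm_eq_lintegral_enorm hint]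

end Represents

/-! ### Total variation and a dominating measure -/

section TotalVariation

variable {X : Type*} [NormedAddCommGroup X] [MeasurableSpace X] [BorelSpace X]
  {φ : LFComplexMeasure X}

theorem measure_le_of_isBounded {μ ν : Measure X}
    (h : ∀ A, MeasurableSet A → IsBounded A → μ A ≤ ν A) : μ ≤ ν := by
  refine Measure.le_iff.2 fun A hA => ?_
  rw [← sum_restrict_annulus μ, ← sum_restrict_annulus ν, Measure.sum_apply _ hA,
    Measure.sum_apply _ hA]
  refine ENNReal.tsum_le_tsum fun n => ?_
  rw [Measure.restrict_apply hA, Measure.restrict_apply hA]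
  exact h _ (hA.inter (measurableSet_annulus n)) ((isBounded_annulus n).subset inter_subset_right)

theorem Represents.totalVariation_eq {N : Measure X} {H : X → ℂ} (h : φ.Represents N id H) :
    φ.totalVariation = N.withDensity fun x => ‖H x‖ₑ := by
  refine IsGLB.sInf_eq (IsLeast.isGLB ⟨fun A hA bA => ?_, fun ν hν => ?_⟩)
  · rw [withDensity_apply _ hA]
    exact h.enorm_apply_le hA bA
  · refine measure_le_of_isBounded fun A hA bA => ?_
    rw [withDensity_apply _ hA]
    exact h.setLIntegral_enorm_le hν hA bA

/-- The sum of the positive and negative parts of the real and imaginary parts of `φ`. -/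
noncomputable def jordanSum (φ : LFComplexMeasure X) : Measure X :=
  φ.rePos + ((-1 : ℂ) • φ).rePos + (((-Complex.I) • φ).rePos + (Complex.I • φ).rePos)

theorem jordanSum_lt_top (φ : LFComplexMeasure X) {A : Set X} (hA : MeasurableSet A)
    (bA : IsBounded A) : φ.jordanSum A < ∞ := by
  simp only [jordanSum, Measure.add_apply, ENNReal.add_lt_top]
  exact ⟨⟨rePos_lt_top _ hA bA, rePos_lt_top _ hA bA⟩, rePos_lt_top _ hA bA, rePos_lt_top _ hA bA⟩

variable [SecondCountableTopology X]

theorem measurable_jordanSum : Measurable (jordanSum : LFComplexMeasure X → Measure X) := by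
  have h : ∀ c : ℂ, Measurable fun φ : LFComplexMeasure X => (c • φ).rePos := fun c =>
    measurable_rePos.comp (measurable_const_smul c)
  refine Measure.measurable_of_measurable_coe _ fun A hA => ?_
  have h' : ∀ c : ℂ, Measurable fun φ : LFComplexMeasure X => (c • φ).rePos A := fun c =>
    (Measure.measurable_coe hA).comp (h c)
  exact (((Measure.measurable_coe hA).comp measurable_rePos).add (h' _)).add ((h' _).add (h' _))

/-- Each of the four Jordan parts lies below their sum, so each has a jointly measurable density,
and these combine to a density of φ. The imaginary part of φ is handled as the real part of -iφ. -/
theorem exists_measurable_jordanSum_density :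
    ∃ f : LFComplexMeasure X → X → ℂ, Measurable (Function.uncurry f) ∧
      ∀ φ : LFComplexMeasure X, φ.Represents φ.jordanSum id (f φ) := by
  let η : Kernel (LFComplexMeasure X) X := ⟨jordanSum, measurable_jordanSum⟩
  let κ : ℂ → Kernel (LFComplexMeasure X) X := fun c =>
    ⟨fun φ => (c • φ).rePos, measurable_rePos.comp (measurable_const_smul c)⟩
  have hη : ∀ φ n, η φ (annulus X n) < ∞ := fun φ n =>
    φ.jordanSum_lt_top (measurableSet_annulus n) (isBounded_annulus n)
  have one_smul' : ∀ φ : LFComplexMeasure X, (1 : ℂ) • φ = φ := fun φ =>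
    ext_bounded fun A _ _ => by simp
  obtain ⟨r₁, m₁, h₁⟩ := exists_measurable_kernel_density (κ 1) η (fun φ => by
    refine Measure.le_iff'.2 fun A => ?_
    change ((1 : ℂ) • φ).rePos A ≤ φ.jordanSum A
    simp only [jordanSum, Measure.add_apply, one_smul']
    rw [add_assoc]; exact le_self_add) hη
  obtain ⟨r₂, m₂, h₂⟩ := exists_measurable_kernel_density (κ (-1)) η (fun φ => by
    refine Measure.le_iff'.2 fun A => ?_
    change ((-1 : ℂ) • φ).rePos A ≤ φ.jordanSum A
    simp only [jordanSum, Measure.add_apply]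
    exact le_add_right le_add_self) hη
  obtain ⟨r₃, m₃, h₃⟩ := exists_measurable_kernel_density (κ (-Complex.I)) η (fun φ => by
    refine Measure.le_iff'.2 fun A => ?_
    change ((-Complex.I) • φ).rePos A ≤ φ.jordanSum A
    simp only [jordanSum, Measure.add_apply]
    exact le_add_left le_self_add) hη
  obtain ⟨r₄, m₄, h₄⟩ := exists_measurable_kernel_density (κ Complex.I) η (fun φ => by
    refine Measure.le_iff'.2 fun A => ?_
    change (Complex.I • φ).rePos A ≤ φ.jordanSum A
    simp only [jordanSum, Measure.add_apply]
    exact le_add_left le_add_self) hη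
  have key : ∀ {c : ℂ} {r : LFComplexMeasure X → X → ℝ≥0∞}, Measurable (Function.uncurry r) →
      (∀ φ, κ c φ = (η φ).withDensity (r φ)) → ∀ φ A, MeasurableSet A → IsBounded A →
      IntegrableOn (fun x => (((r φ x).toReal : ℝ) : ℂ)) A φ.jordanSum ∧
        ∫ x in A, (((r φ x).toReal : ℝ) : ℂ) ∂φ.jordanSum = ((c • φ).rePos.real A : ℝ) := by
    intro c r hm h φ A hA bA
    have hφ : (c • φ).rePos A = ∫⁻ x in A, r φ x ∂φ.jordanSum := by
      have := congrArg (fun μ => μ A) (h φ)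
      rw [withDensity_apply _ hA] at this
      exact this
    have hrm : Measurable (r φ) := hm.comp measurable_prodMk_left
    have hfin : ∫⁻ x in A, r φ x ∂φ.jordanSum ≠ ∞ := by
      rw [← hφ]; exact (rePos_lt_top _ hA bA).ne
    have hint := integrable_toReal_of_lintegral_ne_top hrm.aemeasurable hfin
    refine ⟨hint.ofReal, ?_⟩
    rw [integral_complex_ofReal, integral_toReal hrm.aemeasurable
      (ae_lt_top hrm hfin), measureReal_def, hφ]
  refine ⟨fun φ x => (((r₁ φ x).toReal : ℝ) : ℂ) - (((r₂ φ x).toReal : ℝ) : ℂ) +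
    Complex.I * ((((r₃ φ x).toReal : ℝ) : ℂ) - (((r₄ φ x).toReal : ℝ) : ℂ)), ?_, fun φ => ?_⟩
  · have hof : ∀ {r : LFComplexMeasure X → X → ℝ≥0∞}, Measurable (Function.uncurry r) →
      Measurable fun p : LFComplexMeasure X × X => (((r p.1 p.2).toReal : ℝ) : ℂ) := fun hm =>
        Complex.measurable_ofReal.comp (ENNReal.measurable_toReal.comp hm)
    exact ((hof m₁).sub (hof m₂)).add (((hof m₃).sub (hof m₄)).const_mul _)
  · have hof : ∀ {r : LFComplexMeasure X → X → ℝ≥0∞}, Measurable (Function.uncurry r) →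
      Measurable fun x => (((r φ x).toReal : ℝ) : ℂ) := fun hm =>
        Complex.measurable_ofReal.comp (ENNReal.measurable_toReal.comp
          (hm.comp measurable_prodMk_left))
    refine ⟨measurable_id, ((hof m₁).sub (hof m₂)).add (((hof m₃).sub (hof m₄)).const_mul _),
      fun A hA bA => ?_, fun A hA bA => ?_⟩
    · exact ((key m₁ h₁ φ A hA bA).1.sub (key m₂ h₂ φ A hA bA).1).add
        (((key m₃ h₃ φ A hA bA).1.sub (key m₄ h₄ φ A hA bA).1).const_mul _)
    · obtain ⟨i₁, e₁⟩ := key m₁ h₁ φ A hA bA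
      obtain ⟨i₂, e₂⟩ := key m₂ h₂ φ A hA bA
      obtain ⟨i₃, e₃⟩ := key m₃ h₃ φ A hA bA
      obtain ⟨i₄, e₄⟩ := key m₄ h₄ φ A hA bA
      have e := integral_add (i₁.sub i₂) ((i₃.sub i₄).const_mul Complex.I)
      rw [integral_const_mul, integral_sub' i₁ i₂, integral_sub' i₃ i₄] at e
      refine Eq.trans ?_ e.symm
      rw [e₁, e₂, e₃, e₄, one_smul']
      have hre := φ.re_apply_eq hA bA
      have him := ((-Complex.I) • φ).re_apply_eq hA bA
      have hI : (-1 : ℂ) • (-Complex.I) • φ = Complex.I • φ := ext_bounded fun B _ _ => by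
        simp
      rw [hI] at him
      have him' : (((-Complex.I) • φ) A).re = (φ A).im := by simp
      rw [him'] at him
      rw [← Complex.ofReal_sub, ← Complex.ofReal_sub, ← hre, ← him, mul_comm]
      exact (Complex.re_add_im _).symm

end TotalVariation

/-! ### Jointly measurable polar decomposition and the phase -/

section Polar

variable {X : Type*} [NormedAddCommGroup X] [MeasurableSpace X] [BorelSpace X]

theorem ae_of_ae_restrict_annulus {μ : Measure X} {p : X → Prop}
    (h : ∀ n, ∀ᵐ x ∂(μ.restrict (annulus X n)), p x) : ∀ᵐ x ∂μ, p x := by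
  rw [← sum_restrict_annulus μ]
  exact Measure.ae_sum_iff.2 h

theorem ae_eq_of_forall_setIntegral_eq_of_isBounded {N : Measure X} {H H' : X → ℂ}
    (h : ∀ A, MeasurableSet A → IsBounded A → IntegrableOn H A N)
    (h' : ∀ A, MeasurableSet A → IsBounded A → IntegrableOn H' A N)
    (heq : ∀ A, MeasurableSet A → IsBounded A → ∫ x in A, H x ∂N = ∫ x in A, H' x ∂N) :
    H =ᵐ[N] H' := by
  refine ae_of_ae_restrict_annulus fun n => ?_
  refine Integrable.ae_eq_of_forall_setIntegral_eq _ _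
    (h _ (measurableSet_annulus n) (isBounded_annulus n))
    (h' _ (measurableSet_annulus n) (isBounded_annulus n)) fun A hA _ => ?_
  rw [Measure.restrict_restrict hA]
  exact heq _ (hA.inter (measurableSet_annulus n)) ((isBounded_annulus n).subset inter_subset_right)

variable [SecondCountableTopology X]

theorem totalVariation_lt_top (φ : LFComplexMeasure X) {A : Set X} (bA : IsBounded A) :
    φ.totalVariation A < ∞ := by
  obtain ⟨f, -, hf⟩ := exists_measurable_jordanSum_density (X := X)
  obtain ⟨N, hN⟩ := exists_inter_annulus_eq_empty bA
  have hfin : ∀ B, MeasurableSet B → IsBounded B → φ.totalVariation B < ∞ := fun B hB bB => by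
    rw [(hf φ).totalVariation_eq, withDensity_apply _ hB]
    exact ((hf φ).integrableOn B hB bB).2
  have hsub : A ⊆ ⋃ n ∈ Finset.range N, annulus X n := fun x hx => by
    refine mem_iUnion₂.2 ⟨⌊‖x‖⌋₊, ?_, rfl⟩
    by_contra h
    have : x ∈ A ∩ annulus X ⌊‖x‖⌋₊ := ⟨hx, rfl⟩
    rw [hN _ (by simpa using h)] at this
    exact this
  refine (measure_mono hsub).trans_lt ((measure_biUnion_finset_le _ _).trans_lt ?_)
  exact ENNReal.sum_lt_top.2 fun n _ => hfin _ (measurableSet_annulus n) (isBounded_annulus n)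

theorem measurable_totalVariation :
    Measurable (totalVariation : LFComplexMeasure X → Measure X) := by
  obtain ⟨f, mf, hf⟩ := exists_measurable_jordanSum_density (X := X)
  let η : Kernel (LFComplexMeasure X) X := ⟨jordanSum, measurable_jordanSum⟩
  have : IsSFiniteKernel η := isSFiniteKernel_of_annulus η fun φ n =>
    φ.jordanSum_lt_top (measurableSet_annulus n) (isBounded_annulus n)
  have heq : totalVariation = ⇑(η.withDensity fun φ x => ‖f φ x‖ₑ) := by
    funext φ
    rw [(hf φ).totalVariation_eq, Kernel.withDensity_apply _ (by exact mf.enorm)]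
    rfl
  rw [heq]
  exact Kernel.measurable _

/-- The total variation measure, as a kernel. -/
noncomputable def tvKernel (X : Type*) [NormedAddCommGroup X] [MeasurableSpace X] [BorelSpace X]
    [SecondCountableTopology X] : Kernel (LFComplexMeasure X) X :=
  ⟨totalVariation, measurable_totalVariation⟩

instance : IsSFiniteKernel (tvKernel X) :=
  isSFiniteKernel_of_annulus _ fun φ n => φ.totalVariation_lt_top (isBounded_annulus n)

instance (φ : LFComplexMeasure X) : SFinite φ.totalVariation :=
  inferInstanceAs (SFinite (tvKernel X φ))

/-- Since |φ| has density |f| with respect to the dominating measure, dividing f by its modulus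
gives the density of φ with respect to |φ|. -/
theorem exists_measurable_polar :
    ∃ h : LFComplexMeasure X → X → ℂ, Measurable (Function.uncurry h) ∧ (∀ φ x, ‖h φ x‖ = 1) ∧
      ∀ φ : LFComplexMeasure X, φ.Represents φ.totalVariation id (h φ) := by
  classical
  obtain ⟨f, mf, hf⟩ := exists_measurable_jordanSum_density (X := X)
  -- The value 1 on the |φ|-null set {f = 0} makes the modulus equal to one at every point, not only
  -- almost everywhere.
  let h : LFComplexMeasure X → X → ℂ := fun φ x => if f φ x = 0 then 1 else f φ x / ‖f φ x‖
  have mh : Measurable (Function.uncurry h) :=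
    Measurable.ite (mf (measurableSet_singleton 0)) measurable_const
      (mf.div (Complex.measurable_ofReal.comp mf.norm))
  have h1 : ∀ φ x, ‖h φ x‖ = 1 := fun φ x => by
    by_cases hx : f φ x = 0
    · simp [h, hx]
    · simp [h, hx]
  have mhφ : ∀ φ, Measurable (h φ) := fun φ => mh.comp measurable_prodMk_left
  refine ⟨h, mh, h1, fun φ => ⟨measurable_id, mhφ φ, fun A hA bA => ?_, fun A hA bA => ?_⟩⟩
  · refine IntegrableOn.of_bound (totalVariation_lt_top φ bA) (mhφ φ).aestronglyMeasurable 1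
      (ae_of_all _ fun x => (h1 φ x).le)
  · have hfφ : Measurable fun x => ‖f φ x‖₊ := ((hf φ).measurable_density).nnnorm
    rw [(hf φ).totalVariation_eq, (hf φ).apply_eq A hA bA]
    change _ = ∫ x in A, h φ x ∂(φ.jordanSum.withDensity fun x => (‖f φ x‖₊ : ℝ≥0∞))
    rw [setIntegral_withDensity_eq_setIntegral_smul hfφ _ hA]
    refine integral_congr_ae (ae_of_all _ fun x => ?_)
    by_cases hx : f φ x = 0
    · simp [h, hx]
    · have : (‖f φ x‖ : ℂ) ≠ 0 := by simpa using hx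
      simp only [h, hx, if_false, NNReal.smul_def, coe_nnnorm, Complex.real_smul]
      field_simp

/-- A jointly measurable version of the density of `φ` with respect to `|φ|`. -/
noncomputable def polar (φ : LFComplexMeasure X) (x : X) : ℂ :=
  (exists_measurable_polar (X := X)).choose φ x

theorem measurable_polar : Measurable fun p : LFComplexMeasure X × X => p.1.polar p.2 :=
  (exists_measurable_polar (X := X)).choose_spec.1

theorem norm_polar (φ : LFComplexMeasure X) (x : X) : ‖φ.polar x‖ = 1 :=
  (exists_measurable_polar (X := X)).choose_spec.2.1 φ x

theorem represents_polar (φ : LFComplexMeasure X) :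
    φ.Represents φ.totalVariation id φ.polar :=
  (exists_measurable_polar (X := X)).choose_spec.2.2 φ

theorem measurable_polar_right (φ : LFComplexMeasure X) : Measurable φ.polar :=
  φ.represents_polar.measurable_density

theorem enorm_apply_le_totalVariation (φ : LFComplexMeasure X) {A : Set X} (hA : MeasurableSet A)
    (bA : IsBounded A) : ‖φ A‖ₑ ≤ φ.totalVariation A := by
  refine (φ.represents_polar.enorm_apply_le hA bA).trans (le_of_eq ?_)
  have : ∀ x, ‖φ.polar x‖ₑ = 1 := fun x => by rw [← ofReal_norm, norm_polar, ENNReal.ofReal_one]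
  simp [this]

/-- The principal argument lies in (-π, π]; adding 2π to its negative values moves it into [0, 2π)
without changing the exponential. -/
theorem exists_isPhase (φ : LFComplexMeasure X) : ∃ α : X → ℝ, φ.IsPhase α := by
  have hm := φ.measurable_polar_right
  have harg : Measurable fun x => (φ.polar x).arg := Complex.measurable_arg.comp hm
  have hexp : ∀ x, Complex.exp (Complex.I * ((if 0 ≤ (φ.polar x).arg then (φ.polar x).arg
      else (φ.polar x).arg + 2 * Real.pi : ℝ) : ℂ)) = φ.polar x := fun x => by
    have h := Complex.norm_mul_exp_arg_mul_I (φ.polar x)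
    rw [norm_polar, Complex.ofReal_one, one_mul] at h
    split_ifs
    · rw [mul_comm]; exact h
    · push_cast
      rw [mul_add, Complex.exp_add, mul_comm Complex.I (2 * (Real.pi : ℂ)),
        Complex.exp_two_pi_mul_I, mul_one, mul_comm, h]
  refine ⟨fun x => if 0 ≤ (φ.polar x).arg then (φ.polar x).arg
      else (φ.polar x).arg + 2 * Real.pi, ?_, fun x => ?_, fun A hA bA => ?_⟩
  · exact Measurable.ite (measurableSet_le measurable_const harg) harg (harg.add_const _)
  · have h1 := Complex.neg_pi_lt_arg (φ.polar x)
    have h2 := Complex.arg_le_pi (φ.polar x)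
    have h3 := Real.pi_pos
    dsimp only
    split_ifs with h
    · exact ⟨h, by linarith⟩
    · exact ⟨by linarith, by linarith⟩
  · simp only [hexp]
    exact φ.represents_polar.apply_eq A hA bA

theorem isPhase_phase (φ : LFComplexMeasure X) : φ.IsPhase φ.phase := by
  rw [phase, dif_pos φ.exists_isPhase]
  exact φ.exists_isPhase.choose_spec

theorem Represents.ae_eq_polar {φ : LFComplexMeasure X} {H : X → ℂ}
    (h : φ.Represents φ.totalVariation id H) : H =ᵐ[φ.totalVariation] φ.polar :=
  ae_eq_of_forall_setIntegral_eq_of_isBounded h.integrableOn φ.represents_polar.integrableOn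
    fun A hA bA => (h.apply_eq A hA bA).symm.trans (φ.represents_polar.apply_eq A hA bA)

/-- Both functions are densities of φ with respect to |φ|, and such a density is unique almost
everywhere. Through this the chosen phase, with no measurability in φ, is replaced by the jointly
measurable one. -/
theorem exp_phase_ae_eq_polar (φ : LFComplexMeasure X) :
    (fun x => Complex.exp (Complex.I * φ.phase x)) =ᵐ[φ.totalVariation] φ.polar := by
  obtain ⟨hm, -, hφ⟩ := φ.isPhase_phase
  have hmeas : Measurable fun x => Complex.exp (Complex.I * φ.phase x) :=
    Complex.measurable_exp.comp ((Complex.measurable_ofReal.comp hm).const_mul _)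
  refine Represents.ae_eq_polar ⟨measurable_id, hmeas, fun A hA bA => ?_, hφ⟩
  refine IntegrableOn.of_bound (totalVariation_lt_top φ bA) hmeas.aestronglyMeasurable 1
    (ae_of_all _ fun x => ?_)
  rw [mul_comm, Complex.norm_exp_ofReal_mul_I]

theorem exp_neg_phase_ae_eq (φ : LFComplexMeasure X) :
    (fun x => Complex.exp (-Complex.I * φ.phase x)) =ᵐ[φ.totalVariation]
      fun x => starRingEnd ℂ (φ.polar x) := by
  filter_upwards [φ.exp_phase_ae_eq_polar] with x hx
  rw [← hx, ← Complex.exp_conj, map_mul, Complex.conj_I, Complex.conj_ofReal]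

theorem integral_eq_integral_polar (φ : LFComplexMeasure X) (f : X → ℂ) :
    φ.integral f = ∫ x, f x * φ.polar x ∂φ.totalVariation := by
  refine integral_congr_ae ?_
  filter_upwards [φ.exp_phase_ae_eq_polar] with x hx
  rw [hx]

end Polar

end LFComplexMeasure

/-! ### Comparison of integrals against image complex measures -/

namespace MeasureTheory

theorem integral_simpleFunc_comp_mul {X Z : Type*} [MeasurableSpace X] [MeasurableSpace Z]
    {μ : Measure Z} {T : Z → X} {H : Z → ℂ} (hT : Measurable T) (hH : Integrable H μ)
    (s : SimpleFunc X ℂ) :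
    ∫ z, s (T z) * H z ∂μ = ∑ c ∈ s.range, c * ∫ z in T ⁻¹' (s ⁻¹' {c}), H z ∂μ := by
  have hm : ∀ c, MeasurableSet (T ⁻¹' (s ⁻¹' {c})) := fun c => hT (s.measurableSet_fiber c)
  have heq : ∀ z, s (T z) * H z =
      ∑ c ∈ s.range, (T ⁻¹' (s ⁻¹' {c})).indicator (fun z => c * H z) z := fun z => by
    rw [Finset.sum_eq_single (s (T z))]
    · simp
    · intro c _ hc
      rw [indicator_of_notMem]
      intro hz
      exact hc hz.symm
    · intro hz
      exact absurd (SimpleFunc.mem_range_self s (T z)) hz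
  simp only [heq]
  rw [integral_finsetSum _ fun c _ => (hH.const_mul c).indicator (hm c)]
  refine Finset.sum_congr rfl fun c _ => ?_
  rw [integral_indicator (hm c), integral_const_mul]

theorem tendsto_integral_approxBounded_comp_mul {X Z : Type*} [MeasurableSpace X]
    [MeasurableSpace Z] {μ : Measure Z} {T : Z → X} {H : Z → ℂ} (hT : Measurable T)
    (hH : Integrable H μ) {g : X → ℂ} (hg : StronglyMeasurable g) {C : ℝ}
    (hC : ∀ x, ‖g x‖ ≤ C) :
    Tendsto (fun n => ∫ z, hg.approxBounded C n (T z) * H z ∂μ) atTop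
      (𝓝 (∫ z, g (T z) * H z ∂μ)) := by
  refine tendsto_integral_of_dominated_convergence (fun z => |C| * ‖H z‖) (fun n => ?_)
    (hH.norm.const_mul _) (fun n => ae_of_all _ fun z => ?_) (ae_of_all _ fun z => ?_)
  · exact (((hg.approxBounded C n).measurable.comp
      hT).stronglyMeasurable.aestronglyMeasurable).mul hH.aestronglyMeasurable
  · rw [norm_mul]
    have hC0 : 0 ≤ C := (norm_nonneg _).trans (hC (T z))
    have := hg.norm_approxBounded_le hC0 n (T z)
    rw [abs_of_nonneg hC0]
    gcongr
  · exact (hg.tendsto_approxBounded_of_norm_le (hC (T z))).mul_const _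

/-- Equality on sets gives equality for simple functions, and bounded simple approximations pass to
the limit by dominated convergence. This plays the role of a change of variables for complex
measures. -/
theorem integral_comp_mul_eq_of_forall_setIntegral_eq {X Z₁ Z₂ : Type*}
    [MeasurableSpace X] [MeasurableSpace Z₁] [MeasurableSpace Z₂] {μ₁ : Measure Z₁}
    {μ₂ : Measure Z₂} {T₁ : Z₁ → X} {T₂ : Z₂ → X} {H₁ : Z₁ → ℂ} {H₂ : Z₂ → ℂ}
    (hT₁ : Measurable T₁) (hT₂ : Measurable T₂) (hH₁ : Integrable H₁ μ₁) (hH₂ : Integrable H₂ μ₂)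
    (h : ∀ A, MeasurableSet A → ∫ z in T₁ ⁻¹' A, H₁ z ∂μ₁ = ∫ z in T₂ ⁻¹' A, H₂ z ∂μ₂)
    {g : X → ℂ} (hg : Measurable g) {C : ℝ} (hC : ∀ x, ‖g x‖ ≤ C) :
    ∫ z, g (T₁ z) * H₁ z ∂μ₁ = ∫ z, g (T₂ z) * H₂ z ∂μ₂ := by
  refine tendsto_nhds_unique
    (tendsto_integral_approxBounded_comp_mul hT₁ hH₁ hg.stronglyMeasurable hC)
    ((tendsto_integral_approxBounded_comp_mul hT₂ hH₂ hg.stronglyMeasurable hC).congr fun n => ?_)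
  rw [integral_simpleFunc_comp_mul hT₁ hH₁, integral_simpleFunc_comp_mul hT₂ hH₂]
  exact Finset.sum_congr rfl fun c _ => by rw [h _ (SimpleFunc.measurableSet_fiber _ c)]

end MeasureTheory

namespace LFComplexMeasure

/-! ### Construction, uniqueness and integration of complex measures -/

section Construction

variable {X : Type*} [MeasurableSpace X] [Bornology X] {Z : Type*} [MeasurableSpace Z]

open Classical in
/-- The image under `T` of the complex measure with density `H` with respect to `N`. -/
noncomputable def ofDensity (N : Measure Z) (T : Z → X) (H : Z → ℂ) (hT : Measurable T)
    (hint : ∀ A, MeasurableSet A → IsBounded A → IntegrableOn H (T ⁻¹' A) N) :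
    LFComplexMeasure X where
  toFun A := if MeasurableSet A ∧ IsBounded A then ∫ z in T ⁻¹' A, H z ∂N else 0
  eq_zero' A hA := if_neg hA
  hasSum' f hf hb hd := by
    have hU : MeasurableSet (⋃ i, f i) ∧ IsBounded (⋃ i, f i) := ⟨MeasurableSet.iUnion hf, hb⟩
    have hi : ∀ i, MeasurableSet (f i) ∧ IsBounded (f i) := fun i =>
      ⟨hf i, hb.subset (subset_iUnion f i)⟩
    rw [if_pos hU]
    simp only [hi, and_self, if_true]
    rw [preimage_iUnion]
    refine hasSum_integral_iUnion (fun i => hT (hf i)) (fun i j hij => (hd hij).preimage _) ?_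
    rw [← preimage_iUnion]
    exact hint _ hU.1 hU.2

theorem represents_ofDensity {N : Measure Z} {T : Z → X} {H : Z → ℂ} (hT : Measurable T)
    (hH : Measurable H)
    (hint : ∀ A, MeasurableSet A → IsBounded A → IntegrableOn H (T ⁻¹' A) N) :
    (ofDensity N T H hT hint).Represents N T H :=
  ⟨hT, hH, hint, fun _ hA bA => if_pos ⟨hA, bA⟩⟩

/-- The Dynkin class argument is run inside a bounded set K, because complements of bounded sets
need not be bounded; agreement on K itself is what the complement step uses. -/
theorem ext_of_isPiSystem {φ ψ : LFComplexMeasure X} {𝒞 : Set (Set X)} (hpi : IsPiSystem 𝒞)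
    (hgen : ‹MeasurableSpace X› = MeasurableSpace.generateFrom 𝒞)
    (h : ∀ A : Set X, IsBounded A → ∃ K, A ⊆ K ∧ IsBounded K ∧ MeasurableSet K ∧ φ K = ψ K ∧
      ∀ C ∈ 𝒞, φ (K ∩ C) = ψ (K ∩ C)) : φ = ψ := by
  refine ext_bounded fun A hA bA => ?_
  obtain ⟨K, hAK, bK, mK, hK, hC⟩ := h A bA
  have key : ∀ B, MeasurableSet B → φ (K ∩ B) = ψ (K ∩ B) := by
    intro B hB
    induction B, hB using MeasurableSpace.induction_on_inter hgen hpi with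
    | empty => simp [apply_empty]
    | basic C hC' => exact hC C hC'
    | compl B hB ih =>
      have e : ∀ χ : LFComplexMeasure X, χ K = χ (K ∩ B) + χ (K ∩ Bᶜ) := fun χ => by
        rw [← apply_union χ (mK.inter hB) (mK.inter hB.compl) (bK.subset inter_subset_left)
          (bK.subset inter_subset_left), inter_union_compl]
        exact (disjoint_compl_right.mono inter_subset_right inter_subset_right)
      have h1 := e φ
      have h2 := e ψ
      rw [hK, ih] at h1
      exact add_left_cancel (h1.symm.trans h2)
    | iUnion f hd hf ih =>
      rw [inter_iUnion]
      have e : ∀ χ : LFComplexMeasure X, HasSum (fun i => χ (K ∩ f i)) (χ (⋃ i, K ∩ f i)) :=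
        fun χ => χ.hasSum' _ (fun i => mK.inter (hf i))
          (bK.subset (iUnion_subset fun i => inter_subset_left))
          (fun i j hij => (hd hij).mono inter_subset_right inter_subset_right)
      refine (e φ).unique ?_
      simp only [ih]
      exact e ψ
  rw [← inter_eq_right.2 hAK]
  exact key A hA

end Construction

section Integral

variable {X : Type*} [NormedAddCommGroup X] [MeasurableSpace X] [BorelSpace X]

theorem exists_measurable_isBounded_superset {A : Set X} (bA : IsBounded A) :
    ∃ K, A ⊆ K ∧ MeasurableSet K ∧ IsBounded K := by
  obtain ⟨R, hR⟩ := bA.subset_closedBall 0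
  exact ⟨Metric.closedBall 0 R, hR, Metric.isClosed_closedBall.measurableSet,
    Metric.isBounded_closedBall⟩

theorem ext_prod {φ ψ : LFComplexMeasure (X × X)}
    (h : ∀ A A' : Set X, MeasurableSet A → IsBounded A → MeasurableSet A' → IsBounded A' →
      φ (A ×ˢ A') = ψ (A ×ˢ A')) : φ = ψ := by
  refine ext_of_isPiSystem isPiSystem_prod generateFrom_prod.symm fun A bA => ?_
  obtain ⟨K₁, h₁, m₁, b₁⟩ :=
    exists_measurable_isBounded_superset (isBounded_image_fst_and_snd.2 bA).1
  obtain ⟨K₂, h₂, m₂, b₂⟩ :=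
    exists_measurable_isBounded_superset (isBounded_image_fst_and_snd.2 bA).2
  refine ⟨K₁ ×ˢ K₂, fun p hp => ⟨h₁ ⟨p, hp, rfl⟩, h₂ ⟨p, hp, rfl⟩⟩, b₁.prod b₂, m₁.prod m₂,
    h _ _ m₁ b₁ m₂ b₂, ?_⟩
  rintro _ ⟨C₁, hC₁, C₂, hC₂, rfl⟩
  rw [prod_inter_prod]
  exact h _ _ (m₁.inter hC₁) (b₁.subset inter_subset_left) (m₂.inter hC₂)
    (b₂.subset inter_subset_left)

variable [SecondCountableTopology X] {Z : Type*} [MeasurableSpace Z]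

theorem Represents.integral_eq {φ : LFComplexMeasure X} {N : Measure Z} {T : Z → X} {H : Z → ℂ}
    (h : φ.Represents N T H) {g : X → ℂ} (hg : Measurable g) {C : ℝ} (hC : ∀ x, ‖g x‖ ≤ C)
    (bg : IsBounded (Function.support g)) :
    φ.integral g = ∫ z, g (T z) * H z ∂N := by
  obtain ⟨K, hgK, mK, bK⟩ := exists_measurable_isBounded_superset bg
  have hz : ∀ x, x ∉ K → g x = 0 := fun x hx => by
    by_contra h0
    exact hx (hgK h0)
  rw [integral_eq_integral_polar,
    ← setIntegral_eq_integral_of_forall_compl_eq_zero (s := K) (fun x hx => by simp [hz x hx]),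
    ← setIntegral_eq_integral_of_forall_compl_eq_zero (s := T ⁻¹' K) (μ := N)
      (fun z hz' => by simp [hz (T z) hz'])]
  refine integral_comp_mul_eq_of_forall_setIntegral_eq (T₁ := id) measurable_id h.measurable_map
    (φ.represents_polar.integrableOn K mK bK) (h.integrableOn K mK bK) (fun A hA => ?_) hg hC
  have bAK : IsBounded (A ∩ K) := bK.subset inter_subset_right
  rw [Measure.restrict_restrict (measurable_id hA),
    Measure.restrict_restrict (h.measurable_map hA)]
  exact (φ.represents_polar.apply_eq _ (hA.inter mK) bAK).symm.trans
    (h.apply_eq _ (hA.inter mK) bAK)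

/-- The indicator of a bounded closed set F is the pointwise limit of thickened indicators. These
are supported in the 1-thickening of F, which has finite |φ|-mass and compact closure. Closed sets
form a generating π-system. -/
theorem ext_of_integral_eq [ProperSpace X] {φ ψ : LFComplexMeasure X}
    (h : ∀ f : X → ℂ, Continuous f → HasCompactSupport f → φ.integral f = ψ.integral f) :
    φ = ψ := by
  have hclosed : ∀ F : Set X, IsClosed F → IsBounded F → φ F = ψ F := by
    intro F hF bF
    have hδ : ∀ n : ℕ, 0 < (1 : ℝ) / (n + 1) := fun n => Nat.one_div_pos_of_nat
    let f : ℕ → X → ℂ := fun n x => ((thickenedIndicator (hδ n) F x : ℝ) : ℂ)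
    have hcont : ∀ n, Continuous (f n) := fun n =>
      Complex.continuous_ofReal.comp
        (NNReal.continuous_coe.comp (thickenedIndicator (hδ n) F).continuous)
    have hsupp : ∀ n, Function.support (f n) ⊆ Metric.thickening 1 F := fun n x hx => by
      by_contra hx'
      refine hx ?_
      have : x ∉ Metric.thickening (1 / ((n : ℝ) + 1)) F := fun h' => hx' (by
        refine Metric.thickening_mono ?_ F h'
        rw [div_le_one (by positivity)]
        simp)
      simp only [f]
      rw [thickenedIndicator_zero (hδ n) F this]
      simp
    have hcomp : ∀ n, HasCompactSupport (f n) := fun n =>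
      HasCompactSupport.of_support_subset_isCompact
        (bF.thickening (δ := 1)).isCompact_closure ((hsupp n).trans subset_closure)
    have hlim : ∀ χ : LFComplexMeasure X, Tendsto (fun n => χ.integral (f n)) atTop (𝓝 (χ F)) := by
      intro χ
      have hF' : χ F = ∫ x, F.indicator (fun _ => (1 : ℂ)) x * χ.polar x ∂χ.totalVariation := by
        have h1 := χ.represents_polar.apply_eq F hF.measurableSet bF
        rw [preimage_id, ← integral_indicator hF.measurableSet] at h1
        rw [h1]
        congr 1 with x
        by_cases hx : x ∈ F <;> simp [hx]
      rw [hF']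
      simp only [integral_eq_integral_polar]
      have mth : MeasurableSet (Metric.thickening 1 F) := Metric.isOpen_thickening.measurableSet
      refine tendsto_integral_of_dominated_convergence
        ((Metric.thickening 1 F).indicator fun _ => (1 : ℝ)) (fun n => ?_) ?_
        (fun n => ae_of_all _ fun x => ?_) (ae_of_all _ fun x => ?_)
      · exact ((hcont n).measurable.mul χ.measurable_polar_right).aestronglyMeasurable
      · refine (integrable_indicator_iff mth).2 ?_
        exact integrableOn_const (χ.totalVariation_lt_top bF.thickening).ne
      · rw [norm_mul, norm_polar, mul_one]
        by_cases hx : x ∈ Metric.thickening 1 F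
        · rw [indicator_of_mem hx]
          simp only [f, Complex.norm_real, NNReal.norm_eq]
          exact_mod_cast thickenedIndicator_le_one (hδ n) F x
        · rw [indicator_of_notMem hx]
          have : f n x = 0 := by
            by_contra h0
            exact hx (hsupp n h0)
          simp [this]
      · refine Tendsto.mul_const _ ?_
        have h1 := thickenedIndicator_tendsto_indicator_closure hδ
          tendsto_one_div_add_atTop_nhds_zero_nat F
        rw [hF.closure_eq, tendsto_pi_nhds] at h1
        have h2 : F.indicator (fun _ => (1 : ℂ)) x =
            (((F.indicator (fun _ => (1 : NNReal)) x : NNReal) : ℝ) : ℂ) := by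
          by_cases hx : x ∈ F <;> simp [hx]
        rw [h2]
        exact ((Complex.continuous_ofReal.comp NNReal.continuous_coe).tendsto _).comp (h1 x)
    exact tendsto_nhds_unique (hlim φ) ((hlim ψ).congr fun n => (h _ (hcont n) (hcomp n)).symm)
  refine ext_of_isPiSystem isPiSystem_isClosed
    ((BorelSpace.measurable_eq (α := X)).trans borel_eq_generateFrom_isClosed) fun A bA => ?_
  obtain ⟨R, hR⟩ := bA.subset_closedBall 0
  exact ⟨Metric.closedBall 0 R, hR, Metric.isBounded_closedBall,
    Metric.isClosed_closedBall.measurableSet,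
    hclosed _ Metric.isClosed_closedBall Metric.isBounded_closedBall, fun C hC =>
      hclosed _ (Metric.isClosed_closedBall.inter hC)
        (Metric.isBounded_closedBall.subset inter_subset_left)⟩

end Integral

/-! ### First moment measures of random complex measures -/

section Mixture

variable {X : Type*} [NormedAddCommGroup X] [MeasurableSpace X] [BorelSpace X]
  [SecondCountableTopology X] {Ω : Type*} [MeasurableSpace Ω]

theorem integrableOn_of_norm_le_one {Z : Type*} [MeasurableSpace Z] {N : Measure Z} {H : Z → ℂ}
    (hH : Measurable H) (h1 : ∀ z, ‖H z‖ ≤ 1) {A : Set Z} (hA : N A < ∞) : IntegrableOn H A N :=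
  IntegrableOn.of_bound hA hH.aestronglyMeasurable 1 (ae_of_all _ h1)

theorem integrable_apply_of_lintegral_totalVariation_lt_top {Q : Measure Ω}
    {F : Ω → LFComplexMeasure X} (hF : Measurable F) {A : Set X}
    (hA : MeasurableSet A) (bA : IsBounded A) (hfin : ∫⁻ ω, (F ω).totalVariation A ∂Q < ∞) :
    Integrable (fun ω => F ω A) Q :=
  ⟨((measurable_eval A).comp hF).aestronglyMeasurable,
    (lintegral_mono fun _ => enorm_apply_le_totalVariation _ hA bA).trans_lt hfin⟩

theorem compProd_tvKernel_snd_preimage {Q : Measure Ω} [SFinite Q] {F : Ω → LFComplexMeasure X}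
    (hF : Measurable F) {A : Set X} (hA : MeasurableSet A) :
    (Q ⊗ₘ (tvKernel X).comap F hF) (Prod.snd ⁻¹' A) = ∫⁻ ω, (F ω).totalVariation A ∂Q := by
  rw [Measure.compProd_apply (measurable_snd hA)]
  rfl

theorem measurable_polar_comp {F : Ω → LFComplexMeasure X} (hF : Measurable F) :
    Measurable fun p : Ω × X => (F p.1).polar p.2 :=
  measurable_polar.comp ((hF.comp measurable_fst).prodMk measurable_snd)

/-- The first moment measure `A ↦ ∫ F ω A dQ(ω)` of a measurable map `F` into the complex
measures. -/
noncomputable def mixture (Q : Measure Ω) [SFinite Q] (F : Ω → LFComplexMeasure X)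
    (hF : Measurable F)
    (hfin : ∀ A, MeasurableSet A → IsBounded A → ∫⁻ ω, (F ω).totalVariation A ∂Q < ∞) :
    LFComplexMeasure X :=
  ofDensity (Q ⊗ₘ (tvKernel X).comap F hF) Prod.snd (fun p => (F p.1).polar p.2) measurable_snd
    fun A hA bA => integrableOn_of_norm_le_one (measurable_polar_comp hF)
      (fun p => (norm_polar _ _).le) (by
        rw [compProd_tvKernel_snd_preimage hF hA]
        exact hfin A hA bA)

variable {Q : Measure Ω} [SFinite Q] {F : Ω → LFComplexMeasure X} {hF : Measurable F}
  {hfin : ∀ A, MeasurableSet A → IsBounded A → ∫⁻ ω, (F ω).totalVariation A ∂Q < ∞}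

theorem represents_mixture : (mixture Q F hF hfin).Represents (Q ⊗ₘ (tvKernel X).comap F hF)
    Prod.snd fun p => (F p.1).polar p.2 :=
  represents_ofDensity _ (measurable_polar_comp hF) _

theorem integral_mixture {g : X → ℂ} (hg : Measurable g) {C : ℝ} (hC : ∀ x, ‖g x‖ ≤ C)
    (bg : IsBounded (Function.support g)) :
    (mixture Q F hF hfin).integral g = ∫ ω, (F ω).integral g ∂Q := by
  obtain ⟨K, hgK, mK, bK⟩ := exists_measurable_isBounded_superset bg
  rw [represents_mixture.integral_eq hg hC bg, Measure.integral_compProd]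
  · simp only [integral_eq_integral_polar]
    rfl
  · rw [← integrableOn_iff_integrable_of_support_subset (s := Prod.snd ⁻¹' K)]
    · exact Integrable.bdd_mul (represents_mixture (hfin := hfin).integrableOn K mK bK)
        (hg.comp measurable_snd).aestronglyMeasurable (ae_of_all _ fun p => hC p.2)
    · intro p hp
      refine hgK fun h0 => hp ?_
      simp [h0]

theorem mixture_apply {A : Set X} (hA : MeasurableSet A) (bA : IsBounded A) :
    mixture Q F hF hfin A = ∫ ω, F ω A ∂Q := by
  rw [represents_mixture.apply_eq A hA bA, ← univ_prod, Measure.setIntegral_compProd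
    MeasurableSet.univ hA (by
      rw [univ_prod]; exact represents_mixture (hfin := hfin).integrableOn A hA bA),
    Measure.restrict_univ]
  refine integral_congr_ae (ae_of_all _ fun ω => ?_)
  exact ((F ω).represents_polar.apply_eq A hA bA).symm

end Mixture

/-! ### The product of φ with its conjugate -/

section ProdConj

variable {X : Type*} [NormedAddCommGroup X] [MeasurableSpace X] [BorelSpace X]
  [SecondCountableTopology X]

theorem prod_totalVariation_lt_top (φ : LFComplexMeasure X) {B : Set (X × X)} (bB : IsBounded B) :
    (φ.totalVariation.prod φ.totalVariation) B < ∞ := by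
  have h := isBounded_image_fst_and_snd.2 bB
  refine (measure_mono (t := (Prod.fst '' B) ×ˢ (Prod.snd '' B))
    fun p hp => ⟨⟨p, hp, rfl⟩, ⟨p, hp, rfl⟩⟩).trans_lt ?_
  rw [Measure.prod_prod]
  exact ENNReal.mul_lt_top (φ.totalVariation_lt_top h.1) (φ.totalVariation_lt_top h.2)

theorem measurable_polar_mul_conj :
    Measurable fun p : LFComplexMeasure X × (X × X) =>
      p.1.polar p.2.1 * starRingEnd ℂ (p.1.polar p.2.2) :=
  (measurable_polar.comp (measurable_fst.prodMk (measurable_fst.comp measurable_snd))).mul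
    (Complex.continuous_conj.measurable.comp
      (measurable_polar.comp (measurable_fst.prodMk (measurable_snd.comp measurable_snd))))

theorem norm_polar_mul_conj (φ : LFComplexMeasure X) (p : X × X) :
    ‖φ.polar p.1 * starRingEnd ℂ (φ.polar p.2)‖ = 1 := by
  rw [norm_mul, RCLike.norm_conj, norm_polar, norm_polar, one_mul]

/-- The product of `φ` and its complex conjugate. -/
noncomputable def prodConj (φ : LFComplexMeasure X) : LFComplexMeasure (X × X) :=
  ofDensity (φ.totalVariation.prod φ.totalVariation) id
    (fun p => φ.polar p.1 * starRingEnd ℂ (φ.polar p.2)) measurable_id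
    fun _ _ bA => integrableOn_of_norm_le_one
      (measurable_polar_mul_conj.comp measurable_prodMk_left) (fun p => (norm_polar_mul_conj φ p).le)
      (prod_totalVariation_lt_top φ bA)

theorem represents_prodConj (φ : LFComplexMeasure X) :
    φ.prodConj.Represents (φ.totalVariation.prod φ.totalVariation) id
      fun p => φ.polar p.1 * starRingEnd ℂ (φ.polar p.2) :=
  represents_ofDensity _ (measurable_polar_mul_conj.comp measurable_prodMk_left) _

theorem totalVariation_prodConj (φ : LFComplexMeasure X) :
    φ.prodConj.totalVariation = φ.totalVariation.prod φ.totalVariation := by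
  rw [φ.represents_prodConj.totalVariation_eq]
  have : (fun p : X × X => ‖φ.polar p.1 * starRingEnd ℂ (φ.polar p.2)‖ₑ) = fun _ => 1 := by
    funext p
    rw [← ofReal_norm, norm_polar_mul_conj, ENNReal.ofReal_one]
  rw [this]
  exact withDensity_one

theorem prodConj_apply_prod (φ : LFComplexMeasure X) {A A' : Set X} (hA : MeasurableSet A)
    (bA : IsBounded A) (hA' : MeasurableSet A') (bA' : IsBounded A') :
    φ.prodConj (A ×ˢ A') = φ A * starRingEnd ℂ (φ A') := by
  rw [φ.represents_prodConj.apply_eq _ (hA.prod hA') (bA.prod bA'), preimage_id,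
    setIntegral_prod_mul φ.polar (fun y => starRingEnd ℂ (φ.polar y)), integral_conj,
    φ.represents_polar.apply_eq A hA bA, φ.represents_polar.apply_eq A' hA' bA']
  rfl

theorem measurable_prodConj : Measurable (prodConj : LFComplexMeasure X → _) := by
  refine measurable_of_eval fun B hB bB => ?_
  have h : ∀ φ : LFComplexMeasure X, φ.prodConj B =
      ∫ p, B.indicator (fun p => φ.polar p.1 * starRingEnd ℂ (φ.polar p.2)) p
        ∂((tvKernel X ×ₖ tvKernel X) φ) := fun φ => by
    rw [φ.represents_prodConj.apply_eq B hB bB, preimage_id, ← integral_indicator hB,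
      Kernel.prod_apply]
    rfl
  simp only [h]
  refine StronglyMeasurable.measurable (StronglyMeasurable.integral_kernel_prod_right'
    (κ := tvKernel X ×ₖ tvKernel X) (f := fun q : LFComplexMeasure X × (X × X) =>
      B.indicator (fun p => q.1.polar p.1 * starRingEnd ℂ (q.1.polar p.2)) q.2) ?_)
  exact (measurable_polar_mul_conj.indicator (measurable_snd hB)).stronglyMeasurable

/-- Fubini with x innermost. The remaining factor conj h(φ,y) will be absorbed into φ, which turns
the outer integral into one against the Campbell measure. -/
theorem integral_prodConj (φ : LFComplexMeasure X) {g : X × X → ℂ} (hg : Measurable g) {C : ℝ}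
    (hC : ∀ p, ‖g p‖ ≤ C) (bg : IsBounded (Function.support g)) :
    φ.prodConj.integral g = ∫ y, starRingEnd ℂ (φ.polar y) * φ.integral (fun x => g (x, y))
      ∂φ.totalVariation := by
  obtain ⟨K, hgK, mK, bK⟩ := exists_measurable_isBounded_superset bg
  rw [φ.represents_prodConj.integral_eq hg hC bg]
  simp only [id]
  rw [integral_prod_symm]
  · refine integral_congr_ae (ae_of_all _ fun y => ?_)
    simp only [integral_eq_integral_polar]
    rw [← integral_const_mul]
    refine integral_congr_ae (ae_of_all _ fun x => ?_)
    simp only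
    ring
  · rw [← integrableOn_iff_integrable_of_support_subset (s := K)]
    · exact Integrable.bdd_mul (φ.represents_prodConj.integrableOn K mK bK)
        hg.aestronglyMeasurable (ae_of_all _ hC)
    · intro p hp
      refine hgK fun h0 => hp ?_
      simp [h0]

end ProdConj

/-! ### Multiplication by a complex number -/

section Smul

variable {X : Type*} [NormedAddCommGroup X] [MeasurableSpace X] [BorelSpace X]
  [SecondCountableTopology X]

theorem represents_smul (c : ℂ) (φ : LFComplexMeasure X) :
    (c • φ).Represents φ.totalVariation id fun x => c * φ.polar x :=
  ⟨measurable_id, φ.measurable_polar_right.const_mul c,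
    fun A hA bA => (φ.represents_polar.integrableOn A hA bA).const_mul c, fun A hA bA => by
      rw [smul_apply, integral_const_mul, φ.represents_polar.apply_eq A hA bA]⟩

theorem totalVariation_smul_of_norm_eq_one {c : ℂ} (hc : ‖c‖ = 1) (φ : LFComplexMeasure X) :
    (c • φ).totalVariation = φ.totalVariation := by
  rw [(represents_smul c φ).totalVariation_eq]
  have : (fun x => ‖c * φ.polar x‖ₑ) = fun _ => 1 := by
    funext x
    rw [← ofReal_norm, norm_mul, hc, norm_polar, one_mul, ENNReal.ofReal_one]
  rw [this]
  exact withDensity_one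

theorem integral_smul (c : ℂ) (φ : LFComplexMeasure X) {g : X → ℂ} (hg : Measurable g) {C : ℝ}
    (hC : ∀ x, ‖g x‖ ≤ C) (bg : IsBounded (Function.support g)) :
    (c • φ).integral g = c * φ.integral g := by
  rw [(represents_smul c φ).integral_eq hg hC bg, integral_eq_integral_polar,
    ← integral_const_mul]
  refine integral_congr_ae (ae_of_all _ fun x => ?_)
  simp only [id]
  ring

end Smul

/-! ### Translations of complex measures -/

section Translate

variable {d : ℕ}

local notation "𝔼" => EuclideanSpace ℝ (Fin d)

theorem isBounded_preimage_add {A : Set 𝔼} (bA : IsBounded A) (x : 𝔼) :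
    IsBounded ((fun y => y + x) ⁻¹' A) := by
  have h : (fun y => y + x) ⁻¹' A ⊆ (fun y => y - x) '' A := fun a ha => ⟨a + x, ha, by simp⟩
  exact ((LipschitzWith.id.sub (LipschitzWith.const x)).isBounded_image bA).subset h

theorem translate_apply (x : 𝔼) (φ : LFComplexMeasure 𝔼) (A : Set 𝔼) :
    translate x φ A = φ ((fun y => y + x) ⁻¹' A) := rfl

theorem translate_zero (φ : LFComplexMeasure 𝔼) : translate 0 φ = φ :=
  ext_bounded fun A _ _ => by simp [translate_apply]

theorem translate_translate (x y : 𝔼) (φ : LFComplexMeasure 𝔼) :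
    translate x (translate y φ) = translate (x + y) φ :=
  ext_bounded fun A _ _ => by
    simp only [translate_apply, preimage_preimage]
    congr 2 with z
    rw [add_assoc, add_comm y x]

theorem translate_smul (x : 𝔼) (c : ℂ) (φ : LFComplexMeasure 𝔼) :
    translate x (c • φ) = c • translate x φ := rfl

theorem represents_translate (x : 𝔼) (φ : LFComplexMeasure 𝔼) :
    (translate x φ).Represents φ.totalVariation (fun y => y + x) φ.polar :=
  ⟨measurable_add_const x, φ.measurable_polar_right,
    fun _ hA bA => φ.represents_polar.integrableOn _ (measurable_add_const x hA)
      (isBounded_preimage_add bA x),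
    fun _ hA bA => φ.represents_polar.apply_eq _ (measurable_add_const x hA)
      (isBounded_preimage_add bA x)⟩

theorem represents_translate_map (x : 𝔼) (φ : LFComplexMeasure 𝔼) :
    (translate x φ).Represents (φ.totalVariation.map fun y => y + x) id
      fun y => φ.polar (y - x) := by
  have hm : Measurable fun y => φ.polar (y - x) :=
    φ.measurable_polar_right.comp (measurable_sub_const x)
  have hx := (measurableEmbedding_addRight x)
  refine ⟨measurable_id, hm, fun A hA bA => ?_, fun A hA bA => ?_⟩
  · refine integrableOn_of_norm_le_one hm (fun y => (norm_polar _ _).le) ?_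
    rw [preimage_id, Measure.map_apply (measurable_add_const x) hA]
    exact totalVariation_lt_top _ (isBounded_preimage_add bA x)
  · rw [(represents_translate x φ).apply_eq A hA bA, preimage_id, hx.setIntegral_map]
    simp

theorem totalVariation_translate (x : 𝔼) (φ : LFComplexMeasure 𝔼) :
    (translate x φ).totalVariation = φ.totalVariation.map fun y => y + x := by
  rw [(represents_translate_map x φ).totalVariation_eq]
  have : (fun y => ‖φ.polar (y - x)‖ₑ) = fun _ => 1 := by
    funext y
    rw [← ofReal_norm, norm_polar, ENNReal.ofReal_one]
  rw [this]
  exact withDensity_one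

theorem polar_translate_ae_eq (x : 𝔼) (φ : LFComplexMeasure 𝔼) :
    (fun y => φ.polar (y - x)) =ᵐ[φ.totalVariation.map fun y => y + x] (translate x φ).polar := by
  have h := represents_translate_map x φ
  rw [← totalVariation_translate] at h ⊢
  exact h.ae_eq_polar

theorem polar_translate_add_ae_eq (x : 𝔼) (φ : LFComplexMeasure 𝔼) :
    ∀ᵐ y ∂φ.totalVariation, (translate x φ).polar (y + x) = φ.polar y := by
  have h := ae_of_ae_map (measurable_add_const x).aemeasurable (polar_translate_ae_eq x φ)
  filter_upwards [h] with y hy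
  rw [← hy, add_sub_cancel_right]

theorem integral_translate (x : 𝔼) (φ : LFComplexMeasure 𝔼) {g : 𝔼 → ℂ} (hg : Measurable g)
    {C : ℝ} (hC : ∀ x, ‖g x‖ ≤ C) (bg : IsBounded (Function.support g)) :
    (translate x φ).integral g = φ.integral fun v => g (v + x) := by
  rw [(represents_translate x φ).integral_eq hg hC bg, integral_eq_integral_polar]

/-- The value φ(A - x) is an integral over y of a jointly measurable function of (x, φ, y) against
the kernel |φ|, which gives measurability in both variables at once. -/
theorem measurable_translate_uncurry :
    Measurable fun p : 𝔼 × LFComplexMeasure 𝔼 => translate p.1 p.2 := by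
  refine measurable_of_eval fun A hA bA => ?_
  let κ : Kernel (𝔼 × LFComplexMeasure 𝔼) 𝔼 := (tvKernel 𝔼).comap Prod.snd measurable_snd
  have h : ∀ p : 𝔼 × LFComplexMeasure 𝔼, translate p.1 p.2 A =
      ∫ y, A.indicator (fun _ => (1 : ℂ)) (y + p.1) * p.2.polar y ∂(κ p) := fun p => by
    rw [(represents_translate p.1 p.2).apply_eq A hA bA,
      ← integral_indicator (measurable_add_const p.1 hA)]
    refine integral_congr_ae (ae_of_all _ fun y => ?_)
    by_cases hy : y + p.1 ∈ A <;> simp [indicator, hy]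
  simp only [h]
  refine StronglyMeasurable.measurable (StronglyMeasurable.integral_kernel_prod_right' (κ := κ)
    (f := fun q : (𝔼 × LFComplexMeasure 𝔼) × 𝔼 =>
      A.indicator (fun _ => (1 : ℂ)) (q.2 + q.1.1) * q.1.2.polar q.2) ?_)
  refine Measurable.stronglyMeasurable (Measurable.mul ?_ ?_)
  · exact (measurable_const.indicator hA).comp
      (measurable_snd.add (measurable_fst.comp measurable_fst))
  · exact measurable_polar.comp ((measurable_snd.comp measurable_fst).prodMk measurable_snd)

end Translate

end LFComplexMeasure

/-! ### Translation invariant measures on Euclidean space -/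

section Invariant

variable {d : ℕ}

local notation "𝔼" => EuclideanSpace ℝ (Fin d)

/-- The unit cube `[0, 1)^d`. -/
def unitCube (d : ℕ) : Set (EuclideanSpace ℝ (Fin d)) := {x | ∀ i, x i ∈ Set.Ico (0 : ℝ) 1}

theorem unitCube_eq_preimage : unitCube d =
    (MeasurableEquiv.toLp 2 (Fin d → ℝ)).symm ⁻¹' (Set.univ.pi fun _ => Set.Ico (0 : ℝ) 1) := by
  ext x
  simp [unitCube]

theorem measurableSet_unitCube : MeasurableSet (unitCube d) := by
  rw [unitCube_eq_preimage]
  exact (MeasurableEquiv.measurable _) (MeasurableSet.univ_pi fun _ => measurableSet_Ico)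

theorem volume_unitCube : volume (unitCube d) = 1 := by
  rw [unitCube_eq_preimage, (EuclideanSpace.volume_preserving_symm_measurableEquiv_toLp
    (Fin d)).measure_preimage_equiv, Real.volume_pi_Ico]
  simp

theorem isBounded_unitCube : IsBounded (unitCube d) := by
  refine isBounded_iff_forall_norm_le.2 ⟨√d, fun x hx => ?_⟩
  rw [EuclideanSpace.norm_eq]
  refine Real.sqrt_le_sqrt ?_
  have : ∀ i, ‖x i‖ ^ 2 ≤ 1 := fun i => by
    obtain ⟨h0, h1⟩ := hx i
    rw [Real.norm_eq_abs, sq_abs]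
    nlinarith
  calc ∑ i, ‖x i‖ ^ 2 ≤ ∑ _i : Fin d, (1 : ℝ) := Finset.sum_le_sum fun i _ => this i
    _ = d := by simp

/-- Uniqueness of Haar measure; the constant is read off the unit cube, which has volume one. -/
theorem eq_smul_volume_of_map_add_eq {m : Measure 𝔼}
    (hinv : ∀ x : 𝔼, m.map (fun y => y + x) = m)
    (hfin : ∀ A, MeasurableSet A → IsBounded A → m A < ∞) :
    m = m (unitCube d) • volume := by
  have h1 : m.IsAddLeftInvariant := ⟨fun x => by
    simpa only [add_comm] using hinv x⟩
  have h2 : IsFiniteMeasureOnCompacts m := ⟨fun K hK => hfin K hK.measurableSet hK.isBounded⟩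
  have h3 := Measure.isAddLeftInvariant_eq_smul m volume
  have h4 : m (unitCube d) = m.addHaarScalarFactor volume := by
    conv_lhs => rw [h3]
    rw [Measure.smul_apply, volume_unitCube]
    simp [ENNReal.smul_def]
  rw [h4]
  exact h3

end Invariant

namespace LFComplexMeasure

/-! ### Countable generation of the σ-algebra and uniqueness of kernels -/

section CountablyGenerated

variable {X : Type*} [NormedAddCommGroup X] [MeasurableSpace X] [BorelSpace X]

theorem measurable_of_forall_inter_annulus {Ω : Type*} [MeasurableSpace Ω]
    {F : Ω → LFComplexMeasure X} {𝒞 : Set (Set X)} (hpi : IsPiSystem 𝒞) (huniv : univ ∈ 𝒞)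
    (hgen : ‹MeasurableSpace X› = MeasurableSpace.generateFrom 𝒞)
    (h : ∀ C ∈ 𝒞, ∀ n, Measurable fun ω => F ω (C ∩ annulus X n)) : Measurable F := by
  refine measurable_of_eval fun A hA bA => ?_
  obtain ⟨N, hN⟩ := exists_inter_annulus_eq_empty bA
  simp only [fun ω => apply_eq_sum_annulus (F ω) hA bA hN]
  refine Finset.measurable_sum _ fun n _ => ?_
  have bK : ∀ B : Set X, IsBounded (B ∩ annulus X n) := fun B =>
    (isBounded_annulus n).subset inter_subset_right
  have mK : MeasurableSet (annulus X n) := measurableSet_annulus n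
  -- The induction runs over all measurable sets, so boundedness of A has to be forgotten;
  -- intersecting with the annulus keeps every evaluated set bounded.
  clear hN bA
  induction A, hA using MeasurableSpace.induction_on_inter hgen hpi with
  | empty => simp [apply_empty]
  | basic C hC => exact h C hC n
  | compl B hB ih =>
    have e : ∀ ω, F ω (Bᶜ ∩ annulus X n) = F ω (univ ∩ annulus X n) - F ω (B ∩ annulus X n) :=
      fun ω => by
        rw [eq_sub_iff_add_eq, ← apply_union _ (hB.compl.inter mK) (hB.inter mK) (bK _) (bK _),
          ← union_inter_distrib_right, compl_union_self]
        exact disjoint_compl_left.mono inter_subset_left inter_subset_left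
    simp only [e]
    exact (h _ huniv n).sub ih
  | iUnion f hd hf ih =>
    have e : ∀ ω, HasSum (fun i => F ω (f i ∩ annulus X n)) (F ω ((⋃ i, f i) ∩ annulus X n)) :=
      fun ω => by
        rw [iUnion_inter]
        exact (F ω).hasSum' _ (fun i => (hf i).inter mK)
          ((isBounded_annulus (X := X) n).subset (iUnion_subset fun i => inter_subset_right))
          (fun i j hij => (hd hij).mono inter_subset_left inter_subset_left)
    refine measurable_of_tendsto_metrizable
      (f := fun k ω => ∑ i ∈ Finset.range k, F ω (f i ∩ annulus X n))
      (fun k => Finset.measurable_sum _ fun i _ => ih i)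
      (tendsto_pi_nhds.2 fun ω => (e ω).tendsto_sum_nat)

/-- Evaluations at intersections of annuli with members of a countable generating algebra already
generate the σ-algebra, which is therefore pulled back from a countable power of ℂ. -/
instance [SecondCountableTopology X] :
    MeasurableSpace.CountablyGenerated (LFComplexMeasure X) := by
  obtain ⟨𝒜, hc, h𝒜, hgen⟩ := exists_countable_setAlgebra X
  have := hc.to_subtype
  let J : LFComplexMeasure X → (𝒜 × ℕ → ℂ) := fun φ i => φ (i.1.1 ∩ annulus X i.2)
  have hJ : Measurable J := measurable_pi_lambda _ fun i => measurable_eval _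
  have heq : (instMeasurableSpace : MeasurableSpace (LFComplexMeasure X)) =
      MeasurableSpace.comap J inferInstance := by
    refine le_antisymm ?_ hJ.comap_le
    have hJ' := comap_measurable (m := MeasurableSpace.pi) J
    have hm := @measurable_of_forall_inter_annulus X _ _ _ (LFComplexMeasure X)
      (MeasurableSpace.comap J inferInstance) id 𝒜 h𝒜.isSetRing.isSetSemiring.isPiSystem
      h𝒜.univ_mem hgen fun C hC n =>
        (@measurable_pi_apply (𝒜 × ℕ) (fun _ => ℂ) _ (⟨C, hC⟩, n)).comp hJ'
    intro s hs
    exact hm hs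
  rw [heq]
  exact MeasurableSpace.CountablyGenerated.comap J

/-- On each annulus μ is finite, and the hypothesis applied to indicators says that the two kernels
have the same composition product; with a countably generated target this determines the kernel
almost everywhere. -/
theorem kernel_ae_eq_of_forall_lintegral_eq {Y : Type*} [MeasurableSpace Y]
    [MeasurableSpace.CountablyGenerated Y] {μ : Measure X}
    (hμ : ∀ n, μ (annulus X n) < ∞) (κ η : Kernel X Y) [IsFiniteKernel κ] [IsFiniteKernel η]
    (h : ∀ g : X × Y → ℝ≥0∞, Measurable g →
      ∫⁻ x, ∫⁻ y, g (x, y) ∂(κ x) ∂μ = ∫⁻ x, ∫⁻ y, g (x, y) ∂(η x) ∂μ) : κ =ᵐ[μ] η := by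
  refine ae_of_ae_restrict_annulus fun n => ?_
  have : IsFiniteMeasure (μ.restrict (annulus X n)) := ⟨by
    rw [Measure.restrict_apply_univ]; exact hμ n⟩
  refine Kernel.ae_eq_of_compProd_eq (Measure.ext fun s hs => ?_)
  have key : ∀ (ξ : Kernel X Y) [IsFiniteKernel ξ],
      ((μ.restrict (annulus X n)) ⊗ₘ ξ) s = ∫⁻ x, ∫⁻ y,
        (s ∩ Prod.fst ⁻¹' annulus X n).indicator (fun _ => (1 : ℝ≥0∞)) (x, y) ∂(ξ x) ∂μ := by
    intro ξ _
    rw [Measure.compProd_apply hs, ← lintegral_indicator (measurableSet_annulus n)]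
    refine lintegral_congr fun x => ?_
    by_cases hx : x ∈ annulus X n
    · rw [indicator_of_mem hx, ← lintegral_indicator_one (measurable_prodMk_left hs)]
      refine lintegral_congr fun y => ?_
      by_cases hy : (x, y) ∈ s <;> simp [indicator, hx, hy]
    · rw [indicator_of_notMem hx]
      simp [indicator, hx]
  rw [key, key]
  exact h _ (measurable_const.indicator (hs.inter (measurable_fst (measurableSet_annulus n))))

end CountablyGenerated

/-! ### The Campbell measure and its product structure -/

section Campbell

variable {d : ℕ}

local notation "𝔼" => EuclideanSpace ℝ (Fin d)

/-- The image of `|φ|` under `x ↦ (x, exp (-i α(x)) φ)`, where `α` is the phase of `φ`. -/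
noncomputable def campbellKernel (d : ℕ) : Kernel (LFComplexMeasure (EuclideanSpace ℝ (Fin d)))
    (EuclideanSpace ℝ (Fin d) × LFComplexMeasure (EuclideanSpace ℝ (Fin d))) :=
  (Kernel.id ×ₖ tvKernel (EuclideanSpace ℝ (Fin d))).map
    fun p => (p.2, starRingEnd ℂ (p.1.polar p.2) • p.1)

instance : IsSFiniteKernel (campbellKernel d) := by
  rw [campbellKernel]
  infer_instance

theorem measurable_conj_polar : Measurable fun p : LFComplexMeasure 𝔼 × 𝔼 =>
    starRingEnd ℂ (p.1.polar p.2) :=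
  Complex.continuous_conj.measurable.comp measurable_polar

theorem measurable_conj_polar_smul : Measurable fun p : LFComplexMeasure 𝔼 × 𝔼 =>
    (p.2, starRingEnd ℂ (p.1.polar p.2) • p.1) :=
  measurable_snd.prodMk (measurable_smul.comp (measurable_conj_polar.prodMk measurable_fst))

theorem lintegral_campbellKernel (φ : LFComplexMeasure 𝔼)
    {g : 𝔼 × LFComplexMeasure 𝔼 → ℝ≥0∞} (hg : Measurable g) :
    ∫⁻ z, g z ∂(campbellKernel d φ) =
      ∫⁻ x, g (x, starRingEnd ℂ (φ.polar x) • φ) ∂φ.totalVariation := by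
  rw [campbellKernel, Kernel.map_apply _ measurable_conj_polar_smul,
    lintegral_map hg measurable_conj_polar_smul]
  exact Kernel.lintegral_id_prod (hg.comp measurable_conj_polar_smul) (tvKernel 𝔼) φ

theorem integral_campbellKernel (φ : LFComplexMeasure 𝔼)
    {g : 𝔼 × LFComplexMeasure 𝔼 → ℂ} (hg : Measurable g) :
    ∫ z, g z ∂(campbellKernel d φ) =
      ∫ x, g (x, starRingEnd ℂ (φ.polar x) • φ) ∂φ.totalVariation := by
  have h : campbellKernel d φ =
      φ.totalVariation.map fun x => (x, starRingEnd ℂ (φ.polar x) • φ) := by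
    refine Measure.ext_of_lintegral _ fun g hg => ?_
    rw [lintegral_campbellKernel φ hg]
    exact (lintegral_map hg (measurable_conj_polar_smul.comp measurable_prodMk_left)).symm
  rw [h]
  exact integral_map (measurable_conj_polar_smul.comp measurable_prodMk_left).aemeasurable
    hg.aestronglyMeasurable

/-- The rotations by the phase and by conj h agree |φ|-almost everywhere. Hence the images in the
definition of the Campbell measure depend measurably on φ, without which `bind` would not have its
intended meaning. -/
theorem map_rotatedPair_eq (φ : LFComplexMeasure 𝔼) :
    φ.totalVariation.map (rotatedPair φ) = campbellKernel d φ := by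
  refine Measure.ext_of_lintegral _ fun g hg => ?_
  have hm : Measurable (rotatedPair φ) :=
    measurable_id.prodMk (measurable_smul.comp ((Complex.measurable_exp.comp
      ((Complex.measurable_ofReal.comp φ.isPhase_phase.1).const_mul _)).prodMk measurable_const))
  rw [lintegral_map hg hm, lintegral_campbellKernel φ hg]
  refine lintegral_congr_ae ?_
  filter_upwards [φ.exp_neg_phase_ae_eq] with x hx
  rw [rotatedPair, hx]

/-- Equivariance: both |φ| and the density h are carried along by a translation, the latter up to
null sets, and translation commutes with scalars. -/
theorem lintegral_campbellKernel_translate (φ : LFComplexMeasure 𝔼) (y : 𝔼)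
    {g : 𝔼 × LFComplexMeasure 𝔼 → ℝ≥0∞} (hg : Measurable g) :
    ∫⁻ z, g z ∂(campbellKernel d (translate y φ)) =
      ∫⁻ z, g (z.1 + y, translate y z.2) ∂(campbellKernel d φ) := by
  have hτ : Measurable fun z : 𝔼 × LFComplexMeasure 𝔼 => (z.1 + y, translate y z.2) :=
    (measurable_fst.add_const y).prodMk ((measurable_translate y).comp measurable_snd)
  rw [lintegral_campbellKernel _ hg, totalVariation_translate]
  refine (lintegral_map (hg.comp (measurable_conj_polar_smul.comp measurable_prodMk_left))
    (measurable_add_const y)).trans (Eq.trans ?_ (lintegral_campbellKernel φ (hg.comp hτ)).symm)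
  refine lintegral_congr_ae ?_
  filter_upwards [polar_translate_add_ae_eq y φ] with x hx
  change g (x + y, starRingEnd ℂ ((translate y φ).polar (x + y)) • translate y φ) =
    g (x + y, translate y (starRingEnd ℂ (φ.polar x) • φ))
  rw [hx, translate_smul]

variable {L : Measure (LFComplexMeasure (EuclideanSpace ℝ (Fin d)))}

theorem lintegral_campbell {g : 𝔼 × LFComplexMeasure 𝔼 → ℝ≥0∞} (hg : Measurable g) :
    ∫⁻ z, g z ∂(L.bind (campbellKernel d)) = ∫⁻ φ, ∫⁻ z, g z ∂(campbellKernel d φ) ∂L :=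
  Measure.lintegral_bind (Kernel.measurable _).aemeasurable hg.aemeasurable

theorem lintegral_campbell_translate (hst : ∀ x : 𝔼, L.map (translate x) = L) (y : 𝔼)
    {g : 𝔼 × LFComplexMeasure 𝔼 → ℝ≥0∞} (hg : Measurable g) :
    ∫⁻ z, g (z.1 + y, translate y z.2) ∂(L.bind (campbellKernel d)) =
      ∫⁻ z, g z ∂(L.bind (campbellKernel d)) := by
  have hτ : Measurable fun z : 𝔼 × LFComplexMeasure 𝔼 => (z.1 + y, translate y z.2) :=
    (measurable_fst.add_const y).prodMk ((measurable_translate y).comp measurable_snd)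
  refine (lintegral_campbell (hg.comp hτ)).trans ?_
  rw [lintegral_campbell hg]
  conv_rhs => rw [← hst y]
  rw [lintegral_map hg.lintegral_kernel (measurable_translate y)]
  exact lintegral_congr fun φ => (lintegral_campbellKernel_translate φ y hg).symm

theorem campbell_fst_preimage {A : Set 𝔼} (hA : MeasurableSet A) :
    (L.bind (campbellKernel d)) (Prod.fst ⁻¹' A) = ∫⁻ φ, φ.totalVariation A ∂L := by
  rw [← lintegral_indicator_one (measurable_fst hA),
    lintegral_campbell (measurable_one.indicator (measurable_fst hA))]
  refine lintegral_congr fun φ => ?_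
  rw [lintegral_campbellKernel φ (measurable_one.indicator (measurable_fst hA)),
    ← lintegral_indicator_one hA]
  rfl

/-- The Campbell measure with the second component translated back by the first one. -/
noncomputable def centredCampbell (L : Measure (LFComplexMeasure 𝔼)) :
    Measure (𝔼 × LFComplexMeasure 𝔼) :=
  (L.bind (campbellKernel d)).map fun z => (z.1, translate (-z.1) z.2)

theorem measurable_centre : Measurable fun z : 𝔼 × LFComplexMeasure 𝔼 =>
    (z.1, translate (-z.1) z.2) :=
  measurable_fst.prodMk
    (measurable_translate_uncurry.comp (measurable_fst.neg.prodMk measurable_snd))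

/-- Centring converts the diagonal invariance of C into invariance in the first coordinate alone,
because T_{-(x+y)} T_y = T_{-x}. -/
theorem lintegral_centredCampbell_add (hst : ∀ x : 𝔼, L.map (translate x) = L) (y : 𝔼)
    {g : 𝔼 × LFComplexMeasure 𝔼 → ℝ≥0∞} (hg : Measurable g) :
    ∫⁻ z, g (z.1 + y, z.2) ∂(centredCampbell L) = ∫⁻ z, g z ∂(centredCampbell L) := by
  have hσ : Measurable fun z : 𝔼 × LFComplexMeasure 𝔼 => (z.1 + y, z.2) :=
    (measurable_fst.add_const y).prodMk measurable_snd
  refine (lintegral_map (hg.comp hσ) measurable_centre).trans (Eq.trans ?_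
    ((lintegral_campbell_translate hst y (hg.comp measurable_centre)).trans
      (lintegral_map hg measurable_centre).symm))
  refine lintegral_congr fun z => ?_
  simp [translate_translate]

theorem centredCampbell_prod_univ {A : Set 𝔼} (hA : MeasurableSet A) :
    centredCampbell L (A ×ˢ univ) = ∫⁻ φ, φ.totalVariation A ∂L := by
  rw [centredCampbell, Measure.map_apply measurable_centre (hA.prod MeasurableSet.univ),
    ← campbell_fst_preimage hA]
  congr 1
  ext z
  simp

/-- The Palm measure: the image of the Campbell measure, restricted to the unit cube, under
`(x, φ) ↦ T_{-x} φ`. -/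
noncomputable def palmMeasure (L : Measure (LFComplexMeasure 𝔼)) : Measure (LFComplexMeasure 𝔼) :=
  ((centredCampbell L).restrict (unitCube d ×ˢ univ)).map Prod.snd

theorem palmMeasure_apply {G : Set (LFComplexMeasure 𝔼)} (hG : MeasurableSet G) :
    palmMeasure L G = centredCampbell L (unitCube d ×ˢ G) := by
  rw [palmMeasure, Measure.map_apply measurable_snd hG,
    Measure.restrict_apply (measurable_snd hG)]
  congr 1
  ext z
  simp [and_comm]

theorem palmMeasure_univ :
    palmMeasure L univ = ∫⁻ φ, φ.totalVariation (unitCube d) ∂L := by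
  rw [palmMeasure_apply MeasurableSet.univ, centredCampbell_prod_univ measurableSet_unitCube]

/-- For fixed G, the mass of B × G is a translation invariant, locally finite measure in B, hence a
multiple of Lebesgue measure; its value on the unit cube is the Palm measure of G. No disintegration
theorem is involved. -/
theorem centredCampbell_eq_prod (hst : ∀ x : 𝔼, L.map (translate x) = L)
    (hfin : ∀ A, MeasurableSet A → IsBounded A → ∫⁻ φ, φ.totalVariation A ∂L < ∞) :
    centredCampbell L = (volume : Measure 𝔼).prod (palmMeasure L) := by
  have hQ : IsFiniteMeasure (palmMeasure L) := ⟨by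
    rw [palmMeasure_univ]
    exact hfin _ measurableSet_unitCube isBounded_unitCube⟩
  refine (Measure.prod_eq fun A G hA hG => ?_).symm
  let m : Measure 𝔼 := ((centredCampbell L).restrict (univ ×ˢ G)).map Prod.fst
  have hm : ∀ B, MeasurableSet B → m B = centredCampbell L (B ×ˢ G) := fun B hB => by
    rw [Measure.map_apply measurable_fst hB, Measure.restrict_apply (measurable_fst hB)]
    congr 1
    ext z
    simp
  have hmeq : m = m (unitCube d) • volume := by
    refine eq_smul_volume_of_map_add_eq (fun x => Measure.ext fun B hB => ?_) fun B hB bB => ?_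
    · rw [Measure.map_apply (measurable_add_const x) hB, hm _ (measurable_add_const x hB), hm _ hB,
        ← lintegral_indicator_one (hB.prod hG), ← lintegral_centredCampbell_add hst x
          (measurable_one.indicator (hB.prod hG)),
        ← lintegral_indicator_one ((measurable_add_const x hB).prod hG)]
      rfl
    · rw [hm B hB]
      refine (measure_mono (prod_mono_right (subset_univ G))).trans_lt ?_
      rw [centredCampbell_prod_univ hB]
      exact hfin B hB bB
  rw [← hm A hA, hmeq, Measure.smul_apply, hm _ measurableSet_unitCube, palmMeasure_apply hG,
    smul_eq_mul, mul_comm]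

theorem lintegral_campbell_eq_palmMeasure (hst : ∀ x : 𝔼, L.map (translate x) = L)
    (hfin : ∀ A, MeasurableSet A → IsBounded A → ∫⁻ φ, φ.totalVariation A ∂L < ∞)
    {g : 𝔼 × LFComplexMeasure 𝔼 → ℝ≥0∞} (hg : Measurable g) :
    ∫⁻ z, g z ∂(L.bind (campbellKernel d)) =
      ∫⁻ x, ∫⁻ φ, g (x, translate x φ) ∂(palmMeasure L) ∂volume := by
  have hQ : IsFiniteMeasure (palmMeasure L) := ⟨by
    rw [palmMeasure_univ]
    exact hfin _ measurableSet_unitCube isBounded_unitCube⟩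
  have hτ : Measurable fun z : 𝔼 × LFComplexMeasure 𝔼 => (z.1, translate z.1 z.2) :=
    measurable_fst.prodMk measurable_translate_uncurry
  rw [← lintegral_prod (fun z : 𝔼 × LFComplexMeasure 𝔼 => g (z.1, translate z.1 z.2))
    (hg.comp hτ).aemeasurable, ← centredCampbell_eq_prod hst hfin]
  refine Eq.trans ?_ (lintegral_map (hg.comp hτ) measurable_centre).symm
  simp [translate_translate, translate_zero]

theorem lintegral_totalVariation_eq (hst : ∀ x : 𝔼, L.map (translate x) = L)
    (hfin : ∀ A, MeasurableSet A → IsBounded A → ∫⁻ φ, φ.totalVariation A ∂L < ∞)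
    {A : Set 𝔼} (hA : MeasurableSet A) :
    ∫⁻ φ, φ.totalVariation A ∂L =
      (∫⁻ φ, φ.totalVariation (unitCube d) ∂L) * volume A := by
  have hQ : IsFiniteMeasure (palmMeasure L) := ⟨by
    rw [palmMeasure_univ]
    exact hfin _ measurableSet_unitCube isBounded_unitCube⟩
  rw [← centredCampbell_prod_univ hA, centredCampbell_eq_prod hst hfin, Measure.prod_prod,
    palmMeasure_univ, mul_comm]

end Campbell

/-! ### Second moments through the Palm measure -/

section SecondMoment

variable {d : ℕ}

local notation "𝔼" => EuclideanSpace ℝ (Fin d)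

variable {L Q : Measure (LFComplexMeasure (EuclideanSpace ℝ (Fin d)))}

theorem measurable_totalVariation_apply {X : Type*} [NormedAddCommGroup X] [MeasurableSpace X]
    [BorelSpace X] [SecondCountableTopology X] {A : Set X} (hA : MeasurableSet A) :
    Measurable fun φ : LFComplexMeasure X => φ.totalVariation A :=
  (Measure.measurable_coe hA).comp measurable_totalVariation

theorem lintegral_totalVariation_mul_lt_top
    (hsq : ∀ A, MeasurableSet A → IsBounded A → ∫⁻ φ, φ.totalVariation A ^ 2 ∂L < ∞)
    {A B : Set 𝔼} (hA : MeasurableSet A) (hB : MeasurableSet B) (bA : IsBounded A)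
    (bB : IsBounded B) : ∫⁻ φ, φ.totalVariation A * φ.totalVariation B ∂L < ∞ := by
  refine lt_of_le_of_lt (lintegral_mono fun φ => ?_) (hsq (A ∪ B) (hA.union hB) (bA.union bB))
  rw [sq]
  exact mul_le_mul' (measure_mono subset_union_left) (measure_mono subset_union_right)

/-- A measure `Q` on the space of complex measures which disintegrates the Campbell measure of the
law `L`, in the sense that `C` is the image of `λ ⊗ Q` under `(x, φ) ↦ (x, T_x φ)`. -/
def IsPalmMeasure (L Q : Measure (LFComplexMeasure 𝔼)) : Prop :=
  ∀ g : 𝔼 × LFComplexMeasure 𝔼 → ℝ≥0∞, Measurable g →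
    ∫⁻ z, g z ∂(L.bind (campbellKernel d)) = ∫⁻ x, ∫⁻ φ, g (x, translate x φ) ∂Q ∂volume

/-- On the Campbell side the integral over x in the unit cube W is at most |φ|(W) |φ|(A + W), since
the rotation leaves |φ| unchanged; this has finite mean by local square integrability. -/
theorem IsPalmMeasure.lintegral_totalVariation_lt_top (h : IsPalmMeasure L Q)
    (hsq : ∀ A, MeasurableSet A → IsBounded A → ∫⁻ φ, φ.totalVariation A ^ 2 ∂L < ∞)
    {A : Set 𝔼} (hA : MeasurableSet A) (bA : IsBounded A) :
    ∫⁻ φ, φ.totalVariation A ∂Q < ∞ := by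
  have hc := measurableSet_unitCube (d := d)
  obtain ⟨B, hB, mB, bB⟩ := exists_measurable_isBounded_superset
    (bA.add (isBounded_unitCube (d := d)))
  -- The translation by -z.1 cancels the translation in the disintegration, and the cube has volume
  -- one, so the integral of g is exactly the one to be bounded.
  let g : 𝔼 × LFComplexMeasure 𝔼 → ℝ≥0∞ := fun z =>
    (unitCube d).indicator 1 z.1 * (translate (-z.1) z.2).totalVariation A
  have hg : Measurable g := ((measurable_one.indicator hc).comp measurable_fst).mul
    ((measurable_totalVariation_apply hA).comp (measurable_translate_uncurry.comp
      (measurable_fst.neg.prodMk measurable_snd)))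
  have h1 : ∫⁻ x, ∫⁻ φ, g (x, translate x φ) ∂Q ∂volume = ∫⁻ φ, φ.totalVariation A ∂Q := by
    have : ∀ x : 𝔼, ∫⁻ φ, g (x, translate x φ) ∂Q =
        (unitCube d).indicator 1 x * ∫⁻ φ, φ.totalVariation A ∂Q := fun x => by
      simp only [g, translate_translate, neg_add_cancel, translate_zero]
      exact lintegral_const_mul _ (measurable_totalVariation_apply hA)
    simp only [this]
    rw [lintegral_mul_const _ (measurable_one.indicator hc), lintegral_indicator_one hc,
      volume_unitCube, one_mul]
  rw [← h1, ← h g hg, lintegral_campbell hg]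
  refine lt_of_le_of_lt (lintegral_mono fun φ => ?_)
    (lintegral_totalVariation_mul_lt_top hsq hc mB isBounded_unitCube bB)
  rw [lintegral_campbellKernel φ hg, ← lintegral_indicator_one hc,
    ← lintegral_mul_const _ (measurable_one.indicator hc)]
  refine lintegral_mono fun x => ?_
  simp only [g]
  by_cases hx : x ∈ unitCube d
  · rw [translate_smul, totalVariation_smul_of_norm_eq_one
      (by rw [RCLike.norm_conj, norm_polar]), totalVariation_translate,
      Measure.map_apply (measurable_add_const _) hA]
    gcongr
    intro y hy
    exact hB ⟨y + -x, hy, x, hx, by simp⟩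
  · simp [hx]

theorem lintegral_totalVariation_prodConj_lt_top
    (hsq : ∀ A, MeasurableSet A → IsBounded A → ∫⁻ φ, φ.totalVariation A ^ 2 ∂L < ∞)
    {B : Set (𝔼 × 𝔼)} (bB : IsBounded B) :
    ∫⁻ φ, φ.prodConj.totalVariation B ∂L < ∞ := by
  obtain ⟨K₁, h₁, m₁, b₁⟩ :=
    exists_measurable_isBounded_superset (isBounded_image_fst_and_snd.2 bB).1
  obtain ⟨K₂, h₂, m₂, b₂⟩ :=
    exists_measurable_isBounded_superset (isBounded_image_fst_and_snd.2 bB).2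
  refine lt_of_le_of_lt (lintegral_mono fun φ => ?_)
    (lintegral_totalVariation_mul_lt_top hsq m₁ m₂ b₁ b₂)
  rw [totalVariation_prodConj, ← Measure.prod_prod]
  exact measure_mono fun p hp => ⟨h₁ ⟨p, hp, rfl⟩, h₂ ⟨p, hp, rfl⟩⟩

theorem measurable_integral_slice {f : 𝔼 × 𝔼 → ℂ} (hf : Measurable f) :
    Measurable fun z : 𝔼 × LFComplexMeasure 𝔼 => z.2.integral fun x => f (x, z.1) := by
  simp only [integral_eq_integral_polar]
  let κ : Kernel (𝔼 × LFComplexMeasure 𝔼) 𝔼 := (tvKernel 𝔼).comap Prod.snd measurable_snd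
  refine StronglyMeasurable.measurable (StronglyMeasurable.integral_kernel_prod_right' (κ := κ)
    (f := fun q : (𝔼 × LFComplexMeasure 𝔼) × 𝔼 => f (q.2, q.1.1) * q.1.2.polar q.2) ?_)
  refine Measurable.stronglyMeasurable (Measurable.mul ?_ ?_)
  · exact hf.comp (measurable_snd.prodMk (measurable_fst.comp measurable_fst))
  · exact measurable_polar.comp ((measurable_snd.comp measurable_fst).prodMk measurable_snd)

theorem enorm_integral_slice_le {f : 𝔼 × 𝔼 → ℂ} {C : ℝ} (hC : ∀ p, ‖f p‖ ≤ C)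
    {K₁ K₂ : Set 𝔼} (hK₁ : MeasurableSet K₁) (hK : Function.support f ⊆ K₁ ×ˢ K₂)
    (y : 𝔼) (ψ : LFComplexMeasure 𝔼) :
    ‖ψ.integral fun x => f (x, y)‖ₑ ≤
      ENNReal.ofReal C * (K₂.indicator 1 y * ψ.totalVariation K₁) := by
  have hz : ∀ x, (x, y) ∉ K₁ ×ˢ K₂ → f (x, y) = 0 := fun x hx => by
    by_contra h0
    exact hx (hK h0)
  rw [integral_eq_integral_polar]
  refine (enorm_integral_le_lintegral_enorm _).trans ?_
  rw [← lintegral_indicator_one hK₁, ← lintegral_const_mul _ (measurable_one.indicator hK₁),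
    ← lintegral_const_mul _ ((measurable_one.indicator hK₁).const_mul _)]
  refine lintegral_mono fun x => ?_
  rw [enorm_mul, ← ofReal_norm (ψ.polar x), norm_polar, ENNReal.ofReal_one, mul_one]
  by_cases hxy : (x, y) ∈ K₁ ×ˢ K₂
  · rw [indicator_of_mem hxy.1, indicator_of_mem hxy.2, Pi.one_apply, Pi.one_apply, mul_one,
      mul_one, ← ofReal_norm]
    exact ENNReal.ofReal_le_ofReal (hC _)
  · rw [hz x hxy, enorm_zero]
    exact zero_le

/-- With the support of f inside K₁ × K₂, the integrand is dominated by a constant times 1_{K₂}(y)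
|ψ|(K₁), whose Campbell integral is the mean of |φ|(K₂) |φ|(K₁). -/
theorem integrable_integral_slice
    (hsq : ∀ A, MeasurableSet A → IsBounded A → ∫⁻ φ, φ.totalVariation A ^ 2 ∂L < ∞)
    {f : 𝔼 × 𝔼 → ℂ} (hf : Measurable f) {C : ℝ} (hC : ∀ p, ‖f p‖ ≤ C)
    (bf : IsBounded (Function.support f)) :
    Integrable (fun z : 𝔼 × LFComplexMeasure 𝔼 => z.2.integral fun x => f (x, z.1))
      (L.bind (campbellKernel d)) := by
  refine ⟨(measurable_integral_slice hf).aestronglyMeasurable, ?_⟩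
  obtain ⟨K₁, h₁, m₁, b₁⟩ :=
    exists_measurable_isBounded_superset (isBounded_image_fst_and_snd.2 bf).1
  obtain ⟨K₂, h₂, m₂, b₂⟩ :=
    exists_measurable_isBounded_superset (isBounded_image_fst_and_snd.2 bf).2
  have hK : Function.support f ⊆ K₁ ×ˢ K₂ := fun p hp => ⟨h₁ ⟨p, hp, rfl⟩, h₂ ⟨p, hp, rfl⟩⟩
  have hm : Measurable fun z : 𝔼 × LFComplexMeasure 𝔼 =>
      K₂.indicator (1 : 𝔼 → ℝ≥0∞) z.1 * z.2.totalVariation K₁ :=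
    ((measurable_one.indicator m₂).comp measurable_fst).mul
      ((measurable_totalVariation_apply m₁).comp measurable_snd)
  refine lt_of_le_of_lt (lintegral_mono fun z => enorm_integral_slice_le hC m₁ hK z.1 z.2) ?_
  rw [lintegral_const_mul _ hm]
  refine ENNReal.mul_lt_top ENNReal.ofReal_lt_top ?_
  rw [lintegral_campbell hm]
  refine lt_of_le_of_lt (lintegral_mono fun φ => ?_)
    (lintegral_totalVariation_mul_lt_top hsq m₂ m₁ b₂ b₁)
  rw [lintegral_campbellKernel φ hm, ← lintegral_indicator_one m₂,
    ← lintegral_mul_const _ (measurable_one.indicator m₂)]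
  refine lintegral_mono fun x => ?_
  simp only
  rw [totalVariation_smul_of_norm_eq_one (by rw [RCLike.norm_conj, norm_polar])]

theorem isBounded_support_slice {f : 𝔼 × 𝔼 → ℂ} (bf : IsBounded (Function.support f)) (y : 𝔼) :
    IsBounded (Function.support fun x => f (x, y)) :=
  (isBounded_image_fst_and_snd.2 bf).1.subset fun x hx => ⟨(x, y), hx, rfl⟩

/-- The rotation in the Campbell measure supplies the conjugate density of the second factor, so ∫ f
dμ₂ is the Campbell integral of (y,ψ) ↦ ∫ f(x,y) dψ(x). The disintegration replaces (y,ψ) by (u, T_u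
φ), and the translation moves into the argument of f. -/
theorem integral_mixture_prodConj [SFinite L] [SFinite Q] (h : IsPalmMeasure L Q)
    (hsq : ∀ A, MeasurableSet A → IsBounded A → ∫⁻ φ, φ.totalVariation A ^ 2 ∂L < ∞)
    {f : 𝔼 × 𝔼 → ℂ} (hf : Measurable f) {C : ℝ} (hC : ∀ p, ‖f p‖ ≤ C)
    (bf : IsBounded (Function.support f)) :
    (mixture L prodConj measurable_prodConj fun _ _ bA =>
        lintegral_totalVariation_prodConj_lt_top hsq bA).integral f =
      ∫ u, (mixture Q id measurable_id fun _ hA bA =>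
        h.lintegral_totalVariation_lt_top hsq hA bA).integral (fun v => f (u + v, u)) := by
  have hint := integrable_integral_slice hsq hf hC bf
  have hfy : ∀ y : 𝔼, Measurable fun x => f (x, y) := fun y => hf.comp measurable_prodMk_right
  have hτ : Measurable fun z : 𝔼 × LFComplexMeasure 𝔼 => (z.1, translate z.1 z.2) :=
    measurable_fst.prodMk measurable_translate_uncurry
  have hD : L.bind (campbellKernel d) = ((volume : Measure 𝔼).prod Q).map fun z =>
      (z.1, translate z.1 z.2) := by
    refine Measure.ext_of_lintegral _ fun g hg => ?_
    rw [h g hg, lintegral_map hg hτ]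
    exact (lintegral_prod _ (hg.comp hτ).aemeasurable).symm
  have h1 : ∀ φ : LFComplexMeasure 𝔼, φ.prodConj.integral f =
      ∫ z, z.2.integral (fun x => f (x, z.1)) ∂(campbellKernel d φ) := fun φ => by
    rw [integral_prodConj φ hf hC bf, integral_campbellKernel φ (measurable_integral_slice hf)]
    refine integral_congr_ae (ae_of_all _ fun y => ?_)
    exact (integral_smul _ φ (hfy y) (fun x => hC _) (isBounded_support_slice bf y)).symm
  rw [integral_mixture hf hC bf]
  simp only [h1]
  -- The mixture of the Campbell kernels over L is viewed as a composition of kernels with a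
  -- one-point source, so that Fubini for complex integrands applies.
  have h2 := Kernel.integral_comp (κ := Kernel.const Unit L) (η := campbellKernel d) (a := ())
    (f := fun z => z.2.integral fun x => f (x, z.1)) (by
      rwa [Kernel.comp_apply, Kernel.const_apply])
  rw [Kernel.comp_apply, Kernel.const_apply] at h2
  rw [← h2]
  rw [hD] at hint ⊢
  rw [integral_map hτ.aemeasurable hint.aestronglyMeasurable]
  have hint' := hint.comp_measurable hτ
  refine (integral_prod _ hint').trans (integral_congr_ae (ae_of_all _ fun u => ?_))
  have hadd : ∀ v : 𝔼, f (u + v, u) = f (v + u, u) := fun v => by rw [add_comm]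
  simp only [hadd]
  refine Eq.trans ?_ (integral_mixture (g := fun v => f (v + u, u))
    ((hfy u).comp (measurable_add_const u)) (fun v => hC _)
    (isBounded_preimage_add (isBounded_support_slice bf u) u)).symm
  refine integral_congr_ae (ae_of_all _ fun φ => ?_)
  exact integral_translate u φ (hfy u) (fun x => hC _) (isBounded_support_slice bf u)

end SecondMoment

end LFComplexMeasure

/-! ### From the law back to the random measure -/

section RandomMeasure

variable {d : ℕ} {Θ : Type*} [MeasurableSpace Θ]

local notation "𝔼" => EuclideanSpace ℝ (Fin d)

open LFComplexMeasure

/-- Testing with f(x,y) = g(x - y) k(y), where k is a bump of integral one, gives f(u + v, u) = g(v)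
k(u); the integral over u disappears and ∫ g dν is recovered from μ₂. -/
theorem IsReducedMeasure.eq {μ₂ : LFComplexMeasure (𝔼 × 𝔼)} {ν ν' : LFComplexMeasure 𝔼}
    (h : IsReducedMeasure μ₂ ν) (h' : IsReducedMeasure μ₂ ν') : ν = ν' := by
  refine ext_of_integral_eq fun g hg cg => ?_
  let b : ContDiffBump (0 : 𝔼) := default
  let k : 𝔼 → ℂ := fun x => (b.normed volume x : ℂ)
  have hk : Continuous k := Complex.continuous_ofReal.comp b.continuous_normed
  have ck : HasCompactSupport k := b.hasCompactSupport_normed.comp_left Complex.ofReal_zero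
  have ik : ∫ u, k u = 1 := by
    rw [integral_complex_ofReal, b.integral_normed, Complex.ofReal_one]
  let f : 𝔼 × 𝔼 → ℂ := fun p => g (p.1 - p.2) * k p.2
  have hf : Continuous f :=
    (hg.comp (continuous_fst.sub continuous_snd)).mul (hk.comp continuous_snd)
  have cf : HasCompactSupport f := by
    refine HasCompactSupport.intro (K := (fun p : 𝔼 × 𝔼 => (p.2 + p.1, p.2)) ''
      (tsupport g ×ˢ tsupport k)) ((cg.isCompact.prod ck.isCompact).image (by fun_prop)) ?_
    intro p hp
    by_contra h0
    obtain ⟨h1, h2⟩ := ne_zero_and_ne_zero_of_mul h0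
    exact hp ⟨(p.1 - p.2, p.2), ⟨subset_tsupport _ h1, subset_tsupport _ h2⟩, by simp⟩
  have key : ∀ χ : LFComplexMeasure 𝔼,
      ∫ u, χ.integral (fun v => f (u + v, u)) ∂volume = χ.integral g := fun χ => by
    have : ∀ u, χ.integral (fun v => f (u + v, u)) = χ.integral g * k u := fun u => by
      simp only [LFComplexMeasure.integral, f, add_sub_cancel_left]
      rw [← integral_mul_const]
      refine integral_congr_ae (ae_of_all _ fun v => ?_)
      simp only
      ring
    simp only [this]
    rw [integral_const_mul, ik, mul_one]
  rw [← key ν, ← key ν', ← h f hf cf, ← h' f hf cf]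

theorem ENNReal.add_sq_le_four_mul (a b : ℝ≥0∞) : (a + b) ^ 2 ≤ 4 * (a ^ 2 + b ^ 2) := by
  rcases le_total a b with h | h
  · calc (a + b) ^ 2 ≤ (b + b) ^ 2 := by gcongr
      _ = 4 * b ^ 2 := by ring
      _ ≤ _ := by gcongr; exact le_add_self
  · calc (a + b) ^ 2 ≤ (a + a) ^ 2 := by gcongr
      _ = 4 * a ^ 2 := by ring
      _ ≤ _ := by gcongr; exact le_self_add

theorem LFComplexMeasure.totalVariation_le_re_add_im (φ : LFComplexMeasure 𝔼) :
    φ.totalVariation ≤ φ.rePart.totalVariation + φ.imPart.totalVariation := by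
  refine sInf_le fun A hA bA => ?_
  have h : φ A = φ.rePart A + Complex.I * φ.imPart A := by
    rw [mul_comm]
    exact (Complex.re_add_im _).symm
  rw [h, Measure.add_apply]
  refine (enorm_add_le _ _).trans (add_le_add (enorm_apply_le_totalVariation _ hA bA) ?_)
  rw [enorm_mul, ← ofReal_norm Complex.I, Complex.norm_I, ENNReal.ofReal_one, one_mul]
  exact enorm_apply_le_totalVariation _ hA bA

variable {π : Measure Θ} {Φ : Θ → LFComplexMeasure (EuclideanSpace ℝ (Fin d))}

theorem IsLocallySquareIntegrableRM.lintegral_sq_lt_top (hΦ : Measurable Φ)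
    (h : IsLocallySquareIntegrableRM π Φ) {A : Set 𝔼} (hA : MeasurableSet A) (bA : IsBounded A) :
    ∫⁻ φ, φ.totalVariation A ^ 2 ∂(π.map Φ) < ∞ := by
  rw [lintegral_map ((measurable_totalVariation_apply hA).pow_const 2) hΦ]
  refine lt_of_le_of_lt (lintegral_mono fun θ => ?_)
    ((lintegral_const_mul' 4 _ (by simp)).trans_lt (ENNReal.mul_lt_top (by simp) (h A hA bA)))
  refine le_trans ?_ (ENNReal.add_sq_le_four_mul _ _)
  gcongr
  exact totalVariation_le_re_add_im (Φ θ) A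

theorem lintegral_lt_top_of_lintegral_sq_lt_top {Ω : Type*} [MeasurableSpace Ω] {μ : Measure Ω}
    [IsFiniteMeasure μ] {f : Ω → ℝ≥0∞} (h : ∫⁻ ω, f ω ^ 2 ∂μ < ∞) : ∫⁻ ω, f ω ∂μ < ∞ := by
  refine lt_of_le_of_lt (lintegral_mono (g := fun ω => 1 + f ω ^ 2) fun ω => ?_) ?_
  · rcases le_total (f ω) 1 with h1 | h1
    · exact h1.trans le_self_add
    · refine le_trans ?_ le_add_self
      rw [sq]
      exact le_mul_of_one_le_left' h1
  · rw [lintegral_add_left measurable_const, lintegral_const, one_mul]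
    exact ENNReal.add_lt_top.2 ⟨measure_lt_top _ _, h⟩

theorem intensityRM_eq (hΦ : Measurable Φ) :
    intensityRM π Φ = ∫⁻ φ, φ.totalVariation (unitCube d) ∂(π.map Φ) := by
  rw [lintegral_map (measurable_totalVariation_apply measurableSet_unitCube) hΦ]
  rfl

theorem campbellRM_eq (hΦ : Measurable Φ) :
    campbellRM π Φ = (π.map Φ).bind (campbellKernel d) := by
  refine Measure.ext_of_lintegral _ fun g hg => ?_
  rw [lintegral_campbell hg, lintegral_map hg.lintegral_kernel hΦ, campbellRM]
  simp only [map_rotatedPair_eq]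
  exact Measure.lintegral_bind ((Kernel.measurable _).comp hΦ).aemeasurable hg.aemeasurable

/-- Covariance moves the dependence on x from P_x into the integrand, and ρ is shifted from Lebesgue
measure onto P₀, which gives the unnormalised form of the disintegration. -/
theorem IsPalmFamily.isPalmMeasure (hΦ : Measurable Φ)
    {P : Kernel 𝔼 (LFComplexMeasure 𝔼)} (hP : IsPalmFamily π Φ P)
    (hcov : ∀ x, P x = (P 0).map (LFComplexMeasure.translate x)) :
    IsPalmMeasure (π.map Φ) (intensityRM π Φ • P 0) := by
  intro g hg
  rw [← campbellRM_eq hΦ, hP.2 g hg, lintegral_smul_measure]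
  have h1 : ∀ x, ∫⁻ φ, g (x, φ) ∂(P x) =
      ∫⁻ φ, g (x, LFComplexMeasure.translate x φ) ∂(P 0) := fun x => by
    rw [hcov x]
    exact lintegral_map (hg.comp measurable_prodMk_left) (measurable_translate x)
  have := hP.1
  have hm : Measurable fun x => ∫⁻ φ, g (x, LFComplexMeasure.translate x φ) ∂(P 0) := by
    have hg' : Measurable fun z : 𝔼 × LFComplexMeasure 𝔼 => g (z.1, translate z.1 z.2) :=
      hg.comp (measurable_fst.prodMk measurable_translate_uncurry)
    exact hg'.lintegral_prod_right'
  simp only [h1, lintegral_smul_measure]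
  exact (lintegral_const_mul _ hm).symm

/-- The kernel `x ↦ T_x P₀` of translates of a measure. -/
noncomputable def translateKernel (P₀ : Measure (LFComplexMeasure (EuclideanSpace ℝ (Fin d))))
    [SFinite P₀] :
    Kernel (EuclideanSpace ℝ (Fin d)) (LFComplexMeasure (EuclideanSpace ℝ (Fin d))) where
  toFun x := P₀.map (LFComplexMeasure.translate x)
  measurable' := by
    refine Measure.measurable_of_measurable_coe _ fun G hG => ?_
    simp only [Measure.map_apply (measurable_translate _) hG]
    exact measurable_measure_prodMk_left (measurable_translate_uncurry hG)

theorem translateKernel_apply (P₀ : Measure (LFComplexMeasure 𝔼)) [SFinite P₀] (x : 𝔼) :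
    translateKernel P₀ x = P₀.map (LFComplexMeasure.translate x) := rfl

theorem translateKernel_zero (P₀ : Measure (LFComplexMeasure 𝔼)) [SFinite P₀] :
    translateKernel P₀ 0 = P₀ := by
  rw [translateKernel_apply,
    show LFComplexMeasure.translate (0 : 𝔼) = id from funext translate_zero, Measure.map_id]

theorem exists_isPalmFamily [IsProbabilityMeasure π] (hΦ : Measurable Φ)
    (hstat : IsStationaryRM π Φ)
    (hfin : ∀ A, MeasurableSet A → IsBounded A → ∫⁻ φ, φ.totalVariation A ∂(π.map Φ) < ∞) :
    ∃ P : Kernel 𝔼 (LFComplexMeasure 𝔼), IsPalmFamily π Φ P ∧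
      ∀ x, P x = (P 0).map (LFComplexMeasure.translate x) := by
  have hρ : intensityRM π Φ < ∞ := by
    rw [intensityRM_eq hΦ]
    exact hfin _ measurableSet_unitCube isBounded_unitCube
  obtain ⟨P₀, hP₀, hQ⟩ : ∃ P₀ : Measure (LFComplexMeasure 𝔼), IsProbabilityMeasure P₀ ∧
      palmMeasure (π.map Φ) = intensityRM π Φ • P₀ := by
    have hQ : palmMeasure (π.map Φ) univ = intensityRM π Φ := by
      rw [palmMeasure_univ, intensityRM_eq hΦ]
    -- If ρ = 0 the Palm measure vanishes and any probability measure can serve as P₀; the Dirac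
    -- mass at one realisation is taken.
    by_cases h0 : intensityRM π Φ = 0
    · obtain ⟨θ⟩ := nonempty_of_isProbabilityMeasure π
      refine ⟨Measure.dirac (Φ θ), inferInstance, ?_⟩
      rw [h0, zero_smul, ← Measure.measure_univ_eq_zero, hQ, h0]
    · refine ⟨(intensityRM π Φ)⁻¹ • palmMeasure (π.map Φ), ⟨?_⟩, ?_⟩
      · rw [Measure.smul_apply, hQ, smul_eq_mul, ENNReal.inv_mul_cancel h0 hρ.ne]
      · rw [smul_smul, ENNReal.mul_inv_cancel h0 hρ.ne, one_smul]
  refine ⟨translateKernel P₀, ⟨⟨fun x => ?_⟩, fun g hg => ?_⟩, fun x => ?_⟩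
  · rw [translateKernel_apply]
    exact Measure.isProbabilityMeasure_map (measurable_translate x).aemeasurable
  · have hm : Measurable fun x => ∫⁻ φ, g (x, LFComplexMeasure.translate x φ) ∂P₀ := by
      have hg' : Measurable fun z : 𝔼 × LFComplexMeasure 𝔼 => g (z.1, translate z.1 z.2) :=
        hg.comp (measurable_fst.prodMk measurable_translate_uncurry)
      exact hg'.lintegral_prod_right'
    rw [campbellRM_eq hΦ, lintegral_campbell_eq_palmMeasure hstat hfin hg, hQ,
      lintegral_smul_measure]
    simp only [lintegral_smul_measure, translateKernel_apply]
    refine (lintegral_const_mul _ hm).trans ?_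
    congr 1
    refine lintegral_congr fun x => ?_
    exact (lintegral_map (hg.comp measurable_prodMk_left) (measurable_translate x)).symm
  · rw [translateKernel_zero, translateKernel_apply]

theorem IsPalmFamily.ae_eq {P P' : Kernel 𝔼 (LFComplexMeasure 𝔼)} (hρ : intensityRM π Φ < ∞)
    (h0 : intensityRM π Φ ≠ 0) (hP : IsPalmFamily π Φ P) (hP' : IsPalmFamily π Φ P') :
    P =ᵐ[volume] P' := by
  have := hP.1
  have := hP'.1
  have h : P =ᵐ[intensityRM π Φ • volume] P' :=
    kernel_ae_eq_of_forall_lintegral_eq (fun n => by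
      rw [Measure.smul_apply, smul_eq_mul]
      exact ENNReal.mul_lt_top hρ (isBounded_annulus n).measure_lt_top) P P' fun g hg =>
        (hP.2 g hg).symm.trans (hP'.2 g hg)
  -- A nonzero multiple of Lebesgue measure has the same null sets; for ρ = 0 the disintegration
  -- carries no information.
  exact (Measure.absolutelyContinuous_smul h0).ae_le h

end RandomMeasure

end

/-! ### Assembly of the main theorem -/

theorem mainTheorem2 {d : ℕ} {Θ : Type*} [MeasurableSpace Θ]
    (π : Measure Θ) [IsProbabilityMeasure π]
    (Φ : Θ → LFComplexMeasure (EuclideanSpace ℝ (Fin d))) (hΦ : Measurable Φ)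
    (hstat : IsStationaryRM π Φ) (hsq : IsLocallySquareIntegrableRM π Φ) :
    -- the polar decomposition
    (∀ θ, (Φ θ).IsPhase (Φ θ).phase) ∧
    -- `ρ` is finite and is the intensity of `|Φ|`
    (intensityRM π Φ < ∞ ∧
      ∀ A : Set (EuclideanSpace ℝ (Fin d)), MeasurableSet A →
        ∫⁻ θ, (Φ θ).totalVariation A ∂π = intensityRM π Φ * volume A) ∧
    -- the Campbell measure: σ-finiteness, defining formula, and projection to `ℝ^d`
    (SigmaFinite (campbellRM π Φ) ∧
      (∀ g : EuclideanSpace ℝ (Fin d) × LFComplexMeasure (EuclideanSpace ℝ (Fin d)) → ℝ≥0∞,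
        Measurable g →
          Measurable (fun θ => ∫⁻ x, g (x, Complex.exp (-Complex.I * (Φ θ).phase x) • Φ θ)
            ∂(Φ θ).totalVariation) ∧
          ∫⁻ z, g z ∂(campbellRM π Φ) =
            ∫⁻ θ, ∫⁻ x, g (x, Complex.exp (-Complex.I * (Φ θ).phase x) • Φ θ)
              ∂(Φ θ).totalVariation ∂π) ∧
      (campbellRM π Φ).map Prod.fst = intensityRM π Φ • volume) ∧
    -- existence, covariance and essential uniqueness of the Palm distributions
    (∃ P : Kernel (EuclideanSpace ℝ (Fin d)) (LFComplexMeasure (EuclideanSpace ℝ (Fin d))),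
      IsPalmFamily π Φ P ∧
      (∀ x, P x = (P 0).map (LFComplexMeasure.translate x)) ∧
      (intensityRM π Φ ≠ 0 →
        ∀ P' : Kernel (EuclideanSpace ℝ (Fin d)) (LFComplexMeasure (EuclideanSpace ℝ (Fin d))),
          IsPalmFamily π Φ P' →
            ∀ᵐ x ∂(volume : Measure (EuclideanSpace ℝ (Fin d))),
              P' x = (P 0).map (LFComplexMeasure.translate x))) ∧
    -- the second moment measure and its reduced version exist and are unique
    (∃! μ₂ : LFComplexMeasure (EuclideanSpace ℝ (Fin d) × EuclideanSpace ℝ (Fin d)),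
      IsSecondMomentMeasure π Φ μ₂) ∧
    (∀ μ₂ : LFComplexMeasure (EuclideanSpace ℝ (Fin d) × EuclideanSpace ℝ (Fin d)),
      IsSecondMomentMeasure π Φ μ₂ →
        ∃! ν : LFComplexMeasure (EuclideanSpace ℝ (Fin d)), IsReducedMeasure μ₂ ν) ∧
    -- the reduced second moment measure is `ρ` times the first moment measure of `P 0`
    (∀ (μ₂ : LFComplexMeasure (EuclideanSpace ℝ (Fin d) × EuclideanSpace ℝ (Fin d)))
      (ν : LFComplexMeasure (EuclideanSpace ℝ (Fin d)))
      (P : Kernel (EuclideanSpace ℝ (Fin d)) (LFComplexMeasure (EuclideanSpace ℝ (Fin d)))),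
      IsSecondMomentMeasure π Φ μ₂ → IsReducedMeasure μ₂ ν → IsPalmFamily π Φ P →
      (∀ x, P x = (P 0).map (LFComplexMeasure.translate x)) →
        ∀ A : Set (EuclideanSpace ℝ (Fin d)), MeasurableSet A → IsBounded A →
          (intensityRM π Φ ≠ 0 → Integrable (fun φ => φ A) (P 0)) ∧
          ν A = ((intensityRM π Φ).toReal : ℂ) * ∫ φ, φ A ∂(P 0)) := by
  have hL : IsProbabilityMeasure (π.map Φ) := Measure.isProbabilityMeasure_map hΦ.aemeasurable
  have hsq' : ∀ A : Set (EuclideanSpace ℝ (Fin d)), MeasurableSet A → IsBounded A →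
      ∫⁻ φ, φ.totalVariation A ^ 2 ∂(π.map Φ) < ∞ := fun A hA bA =>
    hsq.lintegral_sq_lt_top hΦ hA bA
  have hfin : ∀ A : Set (EuclideanSpace ℝ (Fin d)), MeasurableSet A → IsBounded A →
      ∫⁻ φ, φ.totalVariation A ∂(π.map Φ) < ∞ := fun A hA bA =>
    lintegral_lt_top_of_lintegral_sq_lt_top (hsq' A hA bA)
  have hρ : intensityRM π Φ < ∞ := by
    rw [intensityRM_eq hΦ]
    exact hfin _ measurableSet_unitCube isBounded_unitCube
  have hint : ∀ A : Set (EuclideanSpace ℝ (Fin d)), MeasurableSet A →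
      ∫⁻ φ, φ.totalVariation A ∂(π.map Φ) = intensityRM π Φ * volume A := fun A hA => by
    rw [intensityRM_eq hΦ]
    exact LFComplexMeasure.lintegral_totalVariation_eq hstat hfin hA
  have hfst : ∀ A : Set (EuclideanSpace ℝ (Fin d)), MeasurableSet A →
      campbellRM π Φ (Prod.fst ⁻¹' A) = intensityRM π Φ * volume A := fun A hA => by
    rw [campbellRM_eq hΦ, LFComplexMeasure.campbell_fst_preimage hA, hint A hA]
  have hinner : ∀ g : EuclideanSpace ℝ (Fin d) × LFComplexMeasure (EuclideanSpace ℝ (Fin d)) →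
      ℝ≥0∞, Measurable g → ∀ θ,
        ∫⁻ x, g (x, Complex.exp (-Complex.I * (Φ θ).phase x) • Φ θ) ∂(Φ θ).totalVariation =
          ∫⁻ z, g z ∂(LFComplexMeasure.campbellKernel d (Φ θ)) := fun g hg θ => by
    rw [LFComplexMeasure.lintegral_campbellKernel _ hg]
    refine lintegral_congr_ae ?_
    filter_upwards [(Φ θ).exp_neg_phase_ae_eq] with x hx
    rw [hx]
  -- One μ₂, chosen without reference to P, serves every covariant Palm family, and each such family
  -- yields a reduced measure of it. Working with ρP₀ avoids a separate case ρ = 0.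
  have hμ₂ : ∃ μ₂ : LFComplexMeasure (EuclideanSpace ℝ (Fin d) × EuclideanSpace ℝ (Fin d)),
      IsSecondMomentMeasure π Φ μ₂ ∧ ∀ P : Kernel (EuclideanSpace ℝ (Fin d))
        (LFComplexMeasure (EuclideanSpace ℝ (Fin d))), IsPalmFamily π Φ P →
        (∀ x, P x = (P 0).map (LFComplexMeasure.translate x)) →
        ∃ ν, IsReducedMeasure μ₂ ν ∧
          ∀ A : Set (EuclideanSpace ℝ (Fin d)), MeasurableSet A → IsBounded A →
            Integrable (fun φ : LFComplexMeasure (EuclideanSpace ℝ (Fin d)) => φ A)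
              (intensityRM π Φ • P 0) ∧
            ν A = ∫ φ, φ A ∂(intensityRM π Φ • P 0) := by
    refine ⟨LFComplexMeasure.mixture (π.map Φ) LFComplexMeasure.prodConj
      LFComplexMeasure.measurable_prodConj fun _ _ bA =>
        LFComplexMeasure.lintegral_totalVariation_prodConj_lt_top hsq' bA, ?_, fun P hP hcov => ?_⟩
    · intro A A' hA bA hA' bA'
      have hi := LFComplexMeasure.integrable_apply_of_lintegral_totalVariation_lt_top
        LFComplexMeasure.measurable_prodConj (hA.prod hA') (bA.prod bA')
        (LFComplexMeasure.lintegral_totalVariation_prodConj_lt_top hsq' (bA.prod bA'))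
      have hm := (LFComplexMeasure.measurable_eval (A ×ˢ A')).comp
        (LFComplexMeasure.measurable_prodConj (X := EuclideanSpace ℝ (Fin d)))
      refine ⟨?_, ?_⟩
      · refine (hi.comp_measurable hΦ).congr (ae_of_all _ fun θ => ?_)
        exact LFComplexMeasure.prodConj_apply_prod (Φ θ) hA bA hA' bA'
      · rw [LFComplexMeasure.mixture_apply (hA.prod hA') (bA.prod bA')]
        refine (integral_map hΦ.aemeasurable hm.aestronglyMeasurable).trans ?_
        exact integral_congr_ae (ae_of_all _ fun θ =>
          LFComplexMeasure.prodConj_apply_prod (Φ θ) hA bA hA' bA')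
    · have hQ := hP.isPalmMeasure hΦ hcov
      have := hP.1
      have : IsFiniteMeasure (intensityRM π Φ • P 0) := ⟨by
        rw [Measure.smul_apply, measure_univ, smul_eq_mul, mul_one]
        exact hρ⟩
      refine ⟨LFComplexMeasure.mixture (intensityRM π Φ • P 0) id measurable_id fun _ hA bA =>
        hQ.lintegral_totalVariation_lt_top hsq' hA bA, fun f hf cf => ?_, fun A hA bA =>
        ⟨LFComplexMeasure.integrable_apply_of_lintegral_totalVariation_lt_top measurable_id hA bA
          (hQ.lintegral_totalVariation_lt_top hsq' hA bA),
          LFComplexMeasure.mixture_apply hA bA⟩⟩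
      obtain ⟨C, hC⟩ := hf.bounded_above_of_compact_support cf
      exact LFComplexMeasure.integral_mixture_prodConj hQ hsq' hf.measurable hC
        (cf.isCompact.isBounded.subset subset_closure)
  obtain ⟨μ₂, hsm, hred⟩ := hμ₂
  have huniq : ∀ μ₂', IsSecondMomentMeasure π Φ μ₂' → μ₂' = μ₂ := fun μ₂' h' =>
    LFComplexMeasure.ext_prod fun A A' hA bA hA' bA' =>
      (h' A A' hA bA hA' bA').2.trans (hsm A A' hA bA hA' bA').2.symm
  obtain ⟨P, hP, hcov⟩ := exists_isPalmFamily hΦ hstat hfin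
  refine ⟨fun θ => (Φ θ).isPhase_phase, ⟨hρ, fun A hA => ?_⟩, ⟨?_, fun g hg => ⟨?_, ?_⟩, ?_⟩,
    ⟨P, hP, hcov, fun h0 P' hP' => ?_⟩, ⟨μ₂, hsm, huniq⟩, fun μ₂' h' => ?_,
    fun μ₂' ν P' h' hν hP' hcov' A hA bA => ?_⟩
  · rw [← hint A hA, lintegral_map (LFComplexMeasure.measurable_totalVariation_apply hA) hΦ]
  -- The preimages of the annuli have Campbell measure ρ times the volume of a bounded set.
  · refine ⟨⟨⟨fun n => Prod.fst ⁻¹' LFComplexMeasure.annulus _ n, fun n => trivial, fun n => ?_,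
      ?_⟩⟩⟩
    · rw [hfst _ (LFComplexMeasure.measurableSet_annulus n)]
      exact ENNReal.mul_lt_top hρ (LFComplexMeasure.isBounded_annulus n).measure_lt_top
    · rw [← preimage_iUnion, LFComplexMeasure.iUnion_annulus, preimage_univ]
  · simp only [hinner g hg]
    exact hg.lintegral_kernel.comp hΦ
  · simp only [hinner g hg]
    rw [campbellRM_eq hΦ, LFComplexMeasure.lintegral_campbell hg,
      lintegral_map hg.lintegral_kernel hΦ]
  · refine Measure.ext fun A hA => ?_
    rw [Measure.map_apply measurable_fst hA, hfst A hA, Measure.smul_apply, smul_eq_mul]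
  · filter_upwards [hP'.ae_eq hρ h0 hP] with x hx
    rw [hx, hcov x]
  · rw [huniq μ₂' h']
    obtain ⟨ν, hν, -⟩ := hred P hP hcov
    exact ⟨ν, hν, fun ν' hν' => hν'.eq hν⟩
  · obtain ⟨ν', hν', hνA⟩ := hred P' hP' hcov'
    rw [huniq μ₂' h'] at hν
    obtain ⟨hi, he⟩ := hνA A hA bA
    -- Integrability for ρP₀ passes to P₀ only when ρ ≠ 0; the formula for ν needs no such case, as
    -- both sides are zero when ρ = 0.
    refine ⟨fun h0 => (integrable_smul_measure h0 hρ.ne).1 hi, ?_⟩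
    rw [hν.eq hν', he, integral_smul_measure, Complex.real_smul]
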